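/- Let $(M^n,g)$ be a Hermitian manifold of complex dimension $n$, with complex structure $J$ and fundamental form $\omega=g(J\cdot,\cdot)$. Its Bismut connection $\nabla^b$ is the unique connection with $\nabla^b g=0$, $\nabla^b J=0$ and totally skew-symmetric torsion; write $T^b$ and $R^b(x,y)=\nabla^b_x\nabla^b_y-\nabla^b_y\nabla^b_x-\nabla^b_{[x,y]}$ for its torsion and curvature, and $R^b(x,y,z,w)=g(R^b(x,y)z,w)$, extended complex multilinearly. The metric $g$ is called Bismut Ambrose–Singer (BAS) if $\nabla^bT^b=0$ and $\nabla^bR^b=0$, and Bismut flat if $R^b=0$. The first and third Bismut Ricci curvatures are $$\mathrm{Ric}^{b(1)}(x,y)=\sum_{i=1}^{n}R^b(x,y,e_i,\bar e_i),\qquad \mathrm{Ric}^{b(3)}(x,y)=\sum_{i=1}^{2n}R^b(\varepsilon_i,x,y,\varepsilon_i),$$ where $(e_i)$ is a local unitary frame of $T^{1,0}M$ and $(\varepsilon_i)$ a local orthonormal frame of $TM$. The metric is Kähler if $d\omega=0$, and balanced if Gauduchon's torsion $1$-form $\eta$ vanishes identically (equivalently, $d(\omega^{n-1})=0$); here $\eta(e_i)=\sum_k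 T^k_{ki}$, where $T(e_i,e_j)=\sum_k T^k_{ij}e_k$ is the torsion of the Chern connection. **Theorem.** Let $(M^n,g)$ be a complete Hermitian manifold which is not Kähler and is BAS, with $\mathrm{Ric}^{b(1)}=0$ and $\mathrm{Ric}^{b(3)}=0$. Then $g$ is not balanced. If moreover $n\le 4$, then $g$ is Bismut flat. -/

import Mathlib

set_option maxSynthPendingDepth 3

open scoped ContDiff Manifold Bundle
open Bundle

/-- The real smooth manifold underlying a complex manifold (a holomorphic atlas is a real
analytic atlas). -/
instance IsManifold.realOfComplex {E : Type*} [NormedAddCommGroup E] [NormedSpace ℂ E]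
    {M : Type*} [TopologicalSpace M] [ChartedSpace E M] [h : IsManifold 𝓘(ℂ, E) ω M] :
    IsManifold 𝓘(ℝ, E) ω M := by
  refine isManifold_of_contDiffOn _ _ _ fun e e' he he' => ?_
  have h1 := (contDiffGroupoid ω 𝓘(ℂ, E)).compatible he he'
  rw [contDiffGroupoid, mem_groupoid_of_pregroupoid] at h1
  have h2 : ContDiffOn ℂ ω (𝓘(ℂ, E) ∘ (e.symm ≫ₕ e') ∘ 𝓘(ℂ, E).symm)
    (𝓘(ℂ, E).symm ⁻¹' (e.symm ≫ₕ e').source ∩ Set.range 𝓘(ℂ, E)) := h1.1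
  exact h2.restrict_scalars ℝ

noncomputable section

/-! ### Local formulas

`E` is a finite-dimensional complex vector space, with complex structure `J x = I • x`.
Throughout, `G : E → (E →L[ℝ] E →L[ℝ] ℝ)` is a metric tensor, expressed in a holomorphic chart with
values in `E`; `p` is a point of the chart, and `x y z w : E` are (constant coordinate) vector
fields. The covariant derivative of the connection with Christoffel map `Γ` is
`∇_x y = D_x y + Γ p x y`. -/

namespace HermitianLocal

variable {E : Type*} [NormedAddCommGroup E] [NormedSpace ℂ E]

/-- The exterior derivative `dω (x, y, z)` of the fundamental form `ω (x, y) = G (J x, y)`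
of the metric `G`, for constant vector fields `x, y, z`. -/
def dOmega (G : E → E →L[ℝ] E →L[ℝ] ℝ) (p x y z : E) : ℝ :=
  fderiv ℝ G p x (Complex.I • y) z + fderiv ℝ G p y (Complex.I • z) x
    + fderiv ℝ G p z (Complex.I • x) y

variable [FiniteDimensional ℂ E]

/-- The 1-form `z ↦ G (∇ᵇ_x y, z)`, for the Bismut connection `∇ᵇ` and constant vector fields
`x, y`, where
`G (∇ᵇ_x y, z) = G (∇ᴸᶜ_x y, z) + ½ dω (J x, J y, J z)`
and `∇ᴸᶜ` is the Levi-Civita connection, given by the Koszul formula. -/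
def bismutForm (G : E → E →L[ℝ] E →L[ℝ] ℝ) (p x y : E) : E →L[ℝ] ℝ :=
  LinearMap.toContinuousLinearMap
    { toFun := fun z =>
        (1 / 2 : ℝ) * (fderiv ℝ G p x y z + fderiv ℝ G p y x z - fderiv ℝ G p z x y)
          + (1 / 2 : ℝ) * dOmega G p (Complex.I • x) (Complex.I • y) (Complex.I • z)
      map_add' := fun z z' => by
        simp only [dOmega, smul_add, map_add, add_apply]; ring
      map_smul' := fun c z => by
        simp only [dOmega, smul_comm Complex.I c, map_smul, smul_apply,
          smul_eq_mul, RingHom.id_apply]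
        ring }

/-- The 1-form `z ↦ G (∇ᶜ_x y, z)`, for the Chern connection `∇ᶜ` and constant vector fields
`x, y`. In terms of the Hermitian form `h (y, z) = G (y, z) - i G (J y, z)` it is
determined by `h (∇ᶜ_x y, z) = ∂_x (h (y, z))`, with `∂_x = ½ (D_x - i D_{J x})`. -/
def chernForm (G : E → E →L[ℝ] E →L[ℝ] ℝ) (p x y : E) : E →L[ℝ] ℝ :=
  (1 / 2 : ℝ) • (fderiv ℝ G p x y - fderiv ℝ G p (Complex.I • x) (Complex.I • y))

/-- The Christoffel map of the Bismut connection: `G (bismut G p x y, z) = bismutForm G p x y z`.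
(`(G p).inverse` is the inverse of the isomorphism `G p` from `E` to its real dual.) -/
def bismut (G : E → E →L[ℝ] E →L[ℝ] ℝ) (p : E) : E →L[ℝ] E →L[ℝ] E :=
  LinearMap.toContinuousBilinearMap
    (LinearMap.mk₂ ℝ (fun x y => (G p).inverse (bismutForm G p x y))
      (fun x x' y => by
        rw [← map_add]; congr 1; ext z
        simp only [bismutForm, dOmega, LinearMap.coe_toContinuousLinearMap', LinearMap.coe_mk,
          AddHom.coe_mk, smul_add, map_add, add_apply]; ring)
      (fun c x y => by
        rw [← map_smul]; congr 1; ext z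
        simp only [bismutForm, dOmega, LinearMap.coe_toContinuousLinearMap', LinearMap.coe_mk,
          AddHom.coe_mk, smul_comm Complex.I c, map_smul, smul_apply,
          smul_eq_mul]; ring)
      (fun x y y' => by
        rw [← map_add]; congr 1; ext z
        simp only [bismutForm, dOmega, LinearMap.coe_toContinuousLinearMap', LinearMap.coe_mk,
          AddHom.coe_mk, smul_add, map_add, add_apply]; ring)
      (fun c x y => by
        rw [← map_smul]; congr 1; ext z
        simp only [bismutForm, dOmega, LinearMap.coe_toContinuousLinearMap', LinearMap.coe_mk,
          AddHom.coe_mk, smul_comm Complex.I c, map_smul, smul_apply,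
          smul_eq_mul]; ring))

/-- The Christoffel map of the Chern connection: `G (chern G p x y, z) = chernForm G p x y z`. -/
def chern (G : E → E →L[ℝ] E →L[ℝ] ℝ) (p : E) : E →L[ℝ] E →L[ℝ] E :=
  LinearMap.toContinuousBilinearMap
    (LinearMap.mk₂ ℝ (fun x y => (G p).inverse (chernForm G p x y))
      (fun x x' y => by
        rw [← map_add]; congr 1; ext z
        simp only [chernForm, smul_add, map_add, add_apply,
          sub_apply, smul_apply, smul_eq_mul]; ring)
      (fun c x y => by
        rw [← map_smul]; congr 1; ext z
        simp only [chernForm, smul_comm Complex.I c, map_smul, sub_apply,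
          smul_apply, smul_eq_mul]; ring)
      (fun x y y' => by
        rw [← map_add]; congr 1; ext z
        simp only [chernForm, smul_add, map_add, add_apply,
          sub_apply, smul_apply, smul_eq_mul]; ring)
      (fun c x y => by
        rw [← map_smul]; congr 1; ext z
        simp only [chernForm, smul_comm Complex.I c, map_smul, sub_apply,
          smul_apply, smul_eq_mul]; ring))

section Connection

variable {V : Type*} [NormedAddCommGroup V] [NormedSpace ℝ V]

/-- The torsion `T (x, y) = ∇_x y - ∇_y x - [x, y]` of the connection with Christoffel map `Γ`. -/
def torsion (Γ : V → V →L[ℝ] V →L[ℝ] V) (p : V) : V →L[ℝ] V →L[ℝ] V :=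
  Γ p - (Γ p).flip

/-- The curvature of the connection with Christoffel map `Γ`, as a trilinear map; see
`curvature_apply` for the formula. -/
def curvature (Γ : V → V →L[ℝ] V →L[ℝ] V) (p : V) : V →L[ℝ] V →L[ℝ] V →L[ℝ] V :=
  fderiv ℝ Γ p - (fderiv ℝ Γ p).flip
    + (ContinuousLinearMap.compL ℝ V V V).bilinearComp (Γ p) (Γ p)
    - ((ContinuousLinearMap.compL ℝ V V V).bilinearComp (Γ p) (Γ p)).flip

/-- `R (x, y) z = ∇_x ∇_y z - ∇_y ∇_x z - ∇_[x, y] z` for constant vector fields. -/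
theorem curvature_apply (Γ : V → V →L[ℝ] V →L[ℝ] V) (p x y z : V) :
    curvature Γ p x y z = fderiv ℝ Γ p x y z - fderiv ℝ Γ p y x z
      + Γ p x (Γ p y z) - Γ p y (Γ p x z) := by
  simp [curvature]

/-- The torsion of the connection with Christoffel map `Γ` is parallel at the point `p`:
`(∇_w T) (x, y) = 0` for all `w, x, y`. -/
def TorsionParallelAt (Γ : V → V →L[ℝ] V →L[ℝ] V) (p : V) : Prop :=
  ∀ w x y : V, fderiv ℝ (torsion Γ) p w x y + Γ p w (torsion Γ p x y)
    - torsion Γ p (Γ p w x) y - torsion Γ p x (Γ p w y) = 0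

/-- The curvature of the connection with Christoffel map `Γ` is parallel at the point `p`:
`(∇_w R) (x, y) z = 0` for all `w, x, y, z`. -/
def CurvatureParallelAt (Γ : V → V →L[ℝ] V →L[ℝ] V) (p : V) : Prop :=
  ∀ w x y z : V, fderiv ℝ (curvature Γ) p w x y z + Γ p w (curvature Γ p x y z)
    - curvature Γ p (Γ p w x) y z - curvature Γ p x (Γ p w y) z
    - curvature Γ p x y (Γ p w z) = 0

/-- The third Ricci curvature `Ric³ (x, y) = ∑ᵢ ⟨R (εᵢ, x) y, εᵢ⟩` (`εᵢ` a real orthonormal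
basis) of the metric connection with Christoffel map `Γ`, i.e. the trace of `z ↦ R (z, x) y`. -/
def ricciThird (Γ : V → V →L[ℝ] V →L[ℝ] V) (p x y : V) : ℝ :=
  LinearMap.trace ℝ V (((curvature Γ p).flip x).flip y : V →L[ℝ] V)

end Connection

/-- The first Ricci curvature `Ric¹ (x, y) = ∑ᵢ ⟨R (x, y) eᵢ, ēᵢ⟩` (`eᵢ` a unitary basis of the
`(1,0)`-vectors) of the Hermitian connection with Christoffel map `Γ`, i.e. the complex
trace of the complex linear endomorphism `R (x, y)`. The complex trace of a complex linear
endomorphism `A` is expressed by real traces: `tr_ℂ A = ½ (tr_ℝ A - i tr_ℝ (J A))`. -/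
def ricciFirst (Γ : E → E →L[ℝ] E →L[ℝ] E) (p x y : E) : ℂ :=
  (1 / 2 : ℂ) *
    ((LinearMap.trace ℝ E (curvature Γ p x y : E →L[ℝ] E) : ℝ)
      - Complex.I * (LinearMap.trace ℝ E (Complex.I • curvature Γ p x y : E →L[ℝ] E) : ℝ))

/-- The (real) torsion 1-form of the metric `G`, the trace of `z ↦ Tᶜ (z, x)`, where `Tᶜ` is the
torsion of the Chern connection. It is `η + η̄ = 2 Re η`, where `η` is Gauduchon's torsion
`(1,0)`-form `η (eᵢ) = ∑ₖ Tᵏₖᵢ`. -/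
def torsionOneForm (G : E → E →L[ℝ] E →L[ℝ] ℝ) (p x : E) : ℝ :=
  LinearMap.trace ℝ E ((torsion (chern G) p).flip x : E →L[ℝ] E)

end HermitianLocal

/-! ### Hermitian manifolds

`M` is a complex manifold modelled on `E`, with a Riemannian metric, i.e. a smoothly varying
real inner product on its real tangent spaces. -/

namespace HermitianManifold

variable (E : Type*) [NormedAddCommGroup E] [NormedSpace ℂ E]
  (M : Type*) [TopologicalSpace M] [ChartedSpace E M] [IsManifold 𝓘(ℂ, E) ω M]

variable {E M} in
/-- The complex structure `J` of the real tangent space of a complex manifold. -/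
def complexStructure (m : M) : TangentSpace 𝓘(ℝ, E) m →L[ℝ] TangentSpace 𝓘(ℝ, E) m :=
  (Complex.I • ContinuousLinearMap.id ℝ E : E →L[ℝ] E)

variable [RiemannianBundle (fun m : M => TangentSpace 𝓘(ℝ, E) m)]

/-- The Riemannian metric is Hermitian: `⟨J u, J v⟩ = ⟨u, v⟩`. -/
def IsHermitian : Prop :=
  ∀ (m : M) (u v : TangentSpace 𝓘(ℝ, E) m),
    inner ℝ (complexStructure m u) (complexStructure m v) = inner ℝ u v

variable {E M} in
/-- The metric tensor in the chart `e`, at the point `p` of the chart. -/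
def metricInChart (e : OpenPartialHomeomorph M E) (p : E) : E →L[ℝ] E →L[ℝ] ℝ :=
  (innerSL ℝ (E := TangentSpace 𝓘(ℝ, E) (e.symm p))).bilinearComp
    (mfderiv 𝓘(ℝ, E) 𝓘(ℝ, E) e.symm p : E →L[ℝ] TangentSpace 𝓘(ℝ, E) (e.symm p))
    (mfderiv 𝓘(ℝ, E) 𝓘(ℝ, E) e.symm p : E →L[ℝ] TangentSpace 𝓘(ℝ, E) (e.symm p))

/-- A tensorial condition on the metric holds on `M`, if it holds at every point of every
holomorphic chart of the atlas. -/
def InCharts (P : (E → E →L[ℝ] E →L[ℝ] ℝ) → E → Prop) : Prop :=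
  ∀ e ∈ atlas E M, ∀ p ∈ e.target, P (metricInChart e) p

/-- The metric is Kähler: `dω = 0`. -/
def IsKahler : Prop :=
  InCharts E M fun G p => ∀ x y z : E, HermitianLocal.dOmega G p x y z = 0

variable [FiniteDimensional ℂ E]

/-- The metric is balanced: Gauduchon's torsion 1-form vanishes. -/
def IsBalanced : Prop :=
  InCharts E M fun G p => ∀ x : E, HermitianLocal.torsionOneForm G p x = 0

/-- The Bismut connection is Ambrose-Singer: its torsion and its curvature are parallel. -/
def IsBismutAmbroseSinger : Prop :=
  InCharts E M fun G p => HermitianLocal.TorsionParallelAt (HermitianLocal.bismut G) p ∧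
    HermitianLocal.CurvatureParallelAt (HermitianLocal.bismut G) p

/-- The first Ricci curvature of the Bismut connection vanishes. -/
def FirstBismutRicciFlat : Prop :=
  InCharts E M fun G p => ∀ x y : E,
    HermitianLocal.ricciFirst (HermitianLocal.bismut G) p x y = 0

/-- The third Ricci curvature of the Bismut connection vanishes. -/
def ThirdBismutRicciFlat : Prop :=
  InCharts E M fun G p => ∀ x y : E,
    HermitianLocal.ricciThird (HermitianLocal.bismut G) p x y = 0

/-- The Bismut connection is flat: its curvature vanishes. -/
def IsBismutFlat : Prop :=
  InCharts E M fun G p => HermitianLocal.curvature (HermitianLocal.bismut G) p = 0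

end HermitianManifold

end

/-! Everything is checked at one point p of a holomorphic chart, in a real basis e_i orthonormal for
the metric at p. Write T and R for the Bismut torsion and curvature, J for the complex structure,
and ξ = ∑ T(e_i, J e_i). By `sum_torsion_I`, ξ is, up to J, a constant and metric duality,
Gauduchon's torsion form, so balanced means ξ = 0.

Not balanced: since T is parallel, the Bianchi identity expresses the cyclic sum of R through the
cyclic sum of T(T(·,·),·). Contract it with J over both pairs of arguments. The curvature side
vanishes because both Ricci tensors do, and since T has no (3,0)-part the torsion side yields 3|ξ|²
= 2|T|² (`norm_sum_torsion_I`). Hence ξ = 0 forces T = 0, that is dω = 0.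

Flat: pair symmetry makes R a symmetric operator on 2-tensors, R = ∑ μ_a A_a ⊗ A_a with A_a
orthonormal, so |R|² = ∑ μ_a². Parallel curvature gives R·R = 0, which makes brackets of
eigenvectors eigenvectors, and Ric³ = 0 reads ∑ μ_a A_a² = 0. Together these give Q := ∑ μ_a μ_c
tr(A_a A_c A_a A_c) ≤ 0 (`sum_trace_nonpos`). It remains to show |R|² = 2Q, in two cases.

If ξ = 0 at p, then T = 0 there, and the torsion-free Bianchi identity paired with R gives |R|² = 2Q
(`eq_zero_of_bianchi`). If ξ ≠ 0, the Ricci identity for T shows that every R(x, y) kills ξ. For n ≤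
4 and Ric¹ = 0, every real combination A of the R(x, y) is then a traceless skew-Hermitian map with
a kernel, so it has at most three nonzero eigenvalues, with sum zero. Newton's identity gives 4 tr
A⁴ = (tr A²)² for real traces, and its polarization, summed against μ_a μ_c, is again |R|² = 2Q
(`eq_zero_of_trace`). -/

namespace HermitianLocal

/-! ### Ricci and Bianchi identities for a connection given by Christoffel maps -/

section Derivatives

variable {V : Type*} [NormedAddCommGroup V] [NormedSpace ℝ V]
variable {F : Type*} [NormedAddCommGroup F] [NormedSpace ℝ F]

/-- Along a line the product rule for operator-valued maps is one-dimensional calculus, so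
evaluations of multilinear-valued maps can be differentiated one argument at a time. All tensor
identities below are differentiated this way. -/
theorem hasLineDerivAt_fderiv {f : V → F} {p : V} (h : DifferentiableAt ℝ f p) (v : V) :
    HasLineDerivAt ℝ f (fderiv ℝ f p v) p v :=
  h.hasFDerivAt.hasLineDerivAt v

theorem _root_.HasLineDerivAt.clm_apply₁ {V F F' : Type*} [NormedAddCommGroup V] [NormedSpace ℝ V]
    [NormedAddCommGroup F] [NormedSpace ℝ F] [NormedAddCommGroup F'] [NormedSpace ℝ F']
    {c : V → F →L[ℝ] F'} {u : V → F} {c' : F →L[ℝ] F'} {u' : F} {p v : V}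
    (hc : HasLineDerivAt ℝ c c' p v) (hu : HasLineDerivAt ℝ u u' p v) :
    HasLineDerivAt ℝ (fun q => c q (u q)) (c' (u p) + c p u') p v := by
  have := HasDerivAt.clm_apply (hc : HasDerivAt _ _ _) (hu : HasDerivAt _ _ _)
  simpa [HasLineDerivAt] using this

theorem _root_.HasLineDerivAt.clm_const {V F F' : Type*} [NormedAddCommGroup V] [NormedSpace ℝ V]
    [NormedAddCommGroup F] [NormedSpace ℝ F] [NormedAddCommGroup F'] [NormedSpace ℝ F']
    {c : V → F →L[ℝ] F'} {c' : F →L[ℝ] F'} {p v : V}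
    (hc : HasLineDerivAt ℝ c c' p v) (u : F) :
    HasLineDerivAt ℝ (fun q => c q u) (c' u) p v := by
  have hu : HasLineDerivAt ℝ (fun _ : V => u) 0 p v := hasDerivAt_const (0 : ℝ) u
  simpa using hc.clm_apply₁ hu

theorem _root_.HasLineDerivAt.add₁ {V F : Type*} [NormedAddCommGroup V] [NormedSpace ℝ V]
    [NormedAddCommGroup F] [NormedSpace ℝ F]
    {f g : V → F} {f' g' : F} {p v : V}
    (hf : HasLineDerivAt ℝ f f' p v) (hg : HasLineDerivAt ℝ g g' p v) :
    HasLineDerivAt ℝ (fun q => f q + g q) (f' + g') p v :=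
  HasDerivAt.add (hf : HasDerivAt _ _ _) (hg : HasDerivAt _ _ _)

theorem _root_.HasLineDerivAt.sub₁ {V F : Type*} [NormedAddCommGroup V] [NormedSpace ℝ V]
    [NormedAddCommGroup F] [NormedSpace ℝ F]
    {f g : V → F} {f' g' : F} {p v : V}
    (hf : HasLineDerivAt ℝ f f' p v) (hg : HasLineDerivAt ℝ g g' p v) :
    HasLineDerivAt ℝ (fun q => f q - g q) (f' - g') p v :=
  HasDerivAt.sub (hf : HasDerivAt _ _ _) (hg : HasDerivAt _ _ _)

/-- Differentiates an identity that holds on a neighbourhood of p. -/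
theorem _root_.HasLineDerivAt.eq_of_eventuallyEq {V F : Type*} [NormedAddCommGroup V]
    [NormedSpace ℝ V] [NormedAddCommGroup F] [NormedSpace ℝ F]
    {f g : V → F} {f' g' : F} {p v : V}
    (hf : HasLineDerivAt ℝ f f' p v) (hg : HasLineDerivAt ℝ g g' p v)
    (h : f =ᶠ[nhds p] g) : f' = g' :=
  hf.unique (hg.congr_of_eventuallyEq h)

/-- The Ricci identity for a parallel vector-valued 2-form. -/
theorem curvature_torsion {Γ S : V → V →L[ℝ] V →L[ℝ] V} {U : Set V} (hU : IsOpen U)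
    (hΓ : DifferentiableOn ℝ Γ U) (hS : ContDiffOn ℝ ∞ S U)
    (h : ∀ q ∈ U, ∀ w x y : V, fderiv ℝ S q w x y + Γ q w (S q x y)
      - S q (Γ q w x) y - S q x (Γ q w y) = 0)
    {p : V} (hp : p ∈ U) (v w x y : V) :
    curvature Γ p v w (S p x y) = S p (curvature Γ p v w x) y + S p x (curvature Γ p v w y) := by
  have hn := hU.mem_nhds hp
  have dΓ : ∀ v, HasLineDerivAt ℝ Γ (fderiv ℝ Γ p v) p v :=
    hasLineDerivAt_fderiv ((hΓ p hp).differentiableAt hn)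
  have dS : ∀ v, HasLineDerivAt ℝ S (fderiv ℝ S p v) p v :=
    hasLineDerivAt_fderiv ((hS.differentiableOn (by simp) p hp).differentiableAt hn)
  have dD : ∀ v, HasLineDerivAt ℝ (fderiv ℝ S) (fderiv ℝ (fderiv ℝ S) p v) p v :=
    hasLineDerivAt_fderiv
      ((((hS.fderiv_of_isOpen hU (m := 1) (by decide)).differentiableOn (by simp)) p hp).differentiableAt
        hn)
  -- The parallelism equation, solved for the first derivative of S, is differentiated once more in
  -- the direction v. Symmetry of the second derivative in v and w then leaves exactly the curvature
  -- terms.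
  have key : ∀ v w, fderiv ℝ (fderiv ℝ S) p v w x y = _ := fun v w =>
    (((dD v).clm_const w).clm_const x).clm_const y |>.eq_of_eventuallyEq
      (((((dS v).clm_apply₁ (((dΓ v).clm_const w).clm_const x)).clm_const y).add₁
        (((dS v).clm_const x).clm_apply₁ (((dΓ v).clm_const w).clm_const y))).sub₁
        (((dΓ v).clm_const w).clm_apply₁ (((dS v).clm_const x).clm_const y)))
      (by
        filter_upwards [hn] with q hq
        have := h q hq w x y
        rw [← sub_eq_zero, ← this]; abel)
  have hsymm : fderiv ℝ (fderiv ℝ S) p v w = fderiv ℝ (fderiv ℝ S) p w v :=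
    ((hS.contDiffAt hn).isSymmSndFDerivAt (by simpa using WithTop.coe_le_coe.2 (le_top : (2 : ℕ∞) ≤ ⊤))) v w
  have e := congrArg (fun L => L x y) hsymm
  simp only [key] at e
  have h1 : ∀ w x y, fderiv ℝ S p w x y = S p (Γ p w x) y + S p x (Γ p w y) - Γ p w (S p x y) :=
    fun w x y => by rw [← sub_eq_zero, ← h p hp w x y]; abel
  simp only [curvature_apply, h1, add_apply, map_add, map_sub, sub_apply] at e ⊢
  rw [← sub_eq_zero] at e ⊢
  rw [← neg_eq_zero, ← e]
  abel

/-- The Ricci identity for a parallel endomorphism-valued 2-form. -/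
theorem curvature_curvature {Γ : V → V →L[ℝ] V →L[ℝ] V} {S : V → V →L[ℝ] V →L[ℝ] V →L[ℝ] V}
    {U : Set V} (hU : IsOpen U)
    (hΓ : DifferentiableOn ℝ Γ U) (hS : ContDiffOn ℝ ∞ S U)
    (h : ∀ q ∈ U, ∀ w x y z : V, fderiv ℝ S q w x y z + Γ q w (S q x y z)
      - S q (Γ q w x) y z - S q x (Γ q w y) z - S q x y (Γ q w z) = 0)
    {p : V} (hp : p ∈ U) (v w x y z : V) :
    curvature Γ p v w (S p x y z) = S p (curvature Γ p v w x) y z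
      + S p x (curvature Γ p v w y) z + S p x y (curvature Γ p v w z) := by
  have hn := hU.mem_nhds hp
  have dΓ : ∀ v, HasLineDerivAt ℝ Γ (fderiv ℝ Γ p v) p v :=
    hasLineDerivAt_fderiv ((hΓ p hp).differentiableAt hn)
  have dS : ∀ v, HasLineDerivAt ℝ S (fderiv ℝ S p v) p v :=
    hasLineDerivAt_fderiv ((hS.differentiableOn (by simp) p hp).differentiableAt hn)
  have dD : ∀ v, HasLineDerivAt ℝ (fderiv ℝ S) (fderiv ℝ (fderiv ℝ S) p v) p v :=
    hasLineDerivAt_fderiv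
      ((((hS.fderiv_of_isOpen hU (m := 1) (by decide)).differentiableOn (by simp)) p hp).differentiableAt
        hn)
  have key : ∀ v w, fderiv ℝ (fderiv ℝ S) p v w x y z = _ := fun v w =>
    ((((dD v).clm_const w).clm_const x).clm_const y).clm_const z |>.eq_of_eventuallyEq
      ((((((dS v).clm_apply₁ (((dΓ v).clm_const w).clm_const x)).clm_const y).clm_const z).add₁
        (((((dS v).clm_const x).clm_apply₁ (((dΓ v).clm_const w).clm_const y)).clm_const z).add₁
        ((((dS v).clm_const x).clm_const y).clm_apply₁ (((dΓ v).clm_const w).clm_const z)))).sub₁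
        (((dΓ v).clm_const w).clm_apply₁ ((((dS v).clm_const x).clm_const y).clm_const z)))
      (by
        filter_upwards [hn] with q hq
        have := h q hq w x y z
        rw [← sub_eq_zero, ← this]; abel)
  have hsymm : fderiv ℝ (fderiv ℝ S) p v w = fderiv ℝ (fderiv ℝ S) p w v :=
    ((hS.contDiffAt hn).isSymmSndFDerivAt (by simpa using WithTop.coe_le_coe.2 (le_top : (2 : ℕ∞) ≤ ⊤))) v w
  have e := congrArg (fun L => L x y z) hsymm
  simp only [key] at e
  have h1 : ∀ w x y z, fderiv ℝ S p w x y z = S p (Γ p w x) y z + S p x (Γ p w y) z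
      + S p x y (Γ p w z) - Γ p w (S p x y z) :=
    fun w x y z => by rw [← sub_eq_zero, ← h p hp w x y z]; abel
  simp only [curvature_apply, h1, add_apply, map_add, map_sub, sub_apply] at e ⊢
  rw [← sub_eq_zero] at e ⊢
  rw [← neg_eq_zero, ← e]
  abel

/-- The first Bianchi identity for a connection with parallel torsion. -/
theorem bianchi {Γ : V → V →L[ℝ] V →L[ℝ] V} {p : V} (hΓ : DifferentiableAt ℝ Γ p)
    (h : TorsionParallelAt Γ p) (x y z : V) :
    curvature Γ p x y z + curvature Γ p y z x + curvature Γ p z x y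
      = torsion Γ p (torsion Γ p x y) z + torsion Γ p (torsion Γ p y z) x
        + torsion Γ p (torsion Γ p z x) y := by
  have dT : ∀ v, fderiv ℝ (torsion Γ) p v = fderiv ℝ Γ p v - (fderiv ℝ Γ p v).flip := fun v => by
    ext x y
    have dΓ := hasLineDerivAt_fderiv hΓ v
    have hd : DifferentiableAt ℝ (torsion Γ) p :=
      hΓ.sub (((ContinuousLinearMap.flipₗᵢ ℝ V V V).differentiable _).comp p hΓ)
    refine ((((hasLineDerivAt_fderiv hd v).clm_const x).clm_const y).unique
      (((dΓ.clm_const x).clm_const y).sub₁ ((dΓ.clm_const y).clm_const x)))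
  have h1 := h x y z
  have h2 := h y z x
  have h3 := h z x y
  simp only [dT, curvature_apply, torsion, sub_apply, ContinuousLinearMap.flip_apply, map_sub,
    ] at h1 h2 h3 ⊢
  rw [← sub_eq_zero]
  have e : ∀ {a b c : V}, a = 0 → b = 0 → c = 0 → a + b + c = 0 := by
    rintro _ _ _ rfl rfl rfl; simp
  rw [← e h1 h2 h3]
  abel

end Derivatives

end HermitianLocal

namespace HermitianLocal

/-! ### The Bismut connection of a Hermitian metric and the symmetries of T and R -/

section Metric

variable {E : Type*} [NormedAddCommGroup E] [NormedSpace ℂ E]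

/-- `G` is a smooth Hermitian metric on the open set `U`. -/
structure IsHermitianMetricOn (G : E → E →L[ℝ] E →L[ℝ] ℝ) (U : Set E) : Prop where
  isOpen : IsOpen U
  contDiffOn : ContDiffOn ℝ ∞ G U
  symm : ∀ p ∈ U, ∀ x y : E, G p x y = G p y x
  pos : ∀ p ∈ U, ∀ x : E, x ≠ 0 → 0 < G p x x
  herm : ∀ p ∈ U, ∀ x y : E, G p (Complex.I • x) (Complex.I • y) = G p x y

namespace IsHermitianMetricOn

variable {G : E → E →L[ℝ] E →L[ℝ] ℝ} {U : Set E} (hG : IsHermitianMetricOn G U)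
  {p : E} (hp : p ∈ U)
include hG hp

omit hG hp in
theorem _root_.Complex.I_smul_I_smul {E : Type*} [AddCommGroup E] [Module ℂ E] (x : E) :
    Complex.I • Complex.I • x = -x := by
  rw [smul_smul, Complex.I_mul_I, neg_one_smul]

theorem hasLineDerivAt (v : E) : HasLineDerivAt ℝ G (fderiv ℝ G p v) p v :=
  hasLineDerivAt_fderiv ((hG.contDiffOn.differentiableOn (by simp) p hp).differentiableAt
    (hG.isOpen.mem_nhds hp)) v

theorem fderiv_symm (w x y : E) : fderiv ℝ G p w x y = fderiv ℝ G p w y x :=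
  (((hG.hasLineDerivAt hp w).clm_const x).clm_const y).eq_of_eventuallyEq
    (((hG.hasLineDerivAt hp w).clm_const y).clm_const x)
    (by filter_upwards [hG.isOpen.mem_nhds hp] with q hq using hG.symm q hq x y)

theorem fderiv_herm (w x y : E) :
    fderiv ℝ G p w (Complex.I • x) (Complex.I • y) = fderiv ℝ G p w x y :=
  (((hG.hasLineDerivAt hp w).clm_const _).clm_const _).eq_of_eventuallyEq
    (((hG.hasLineDerivAt hp w).clm_const x).clm_const y)
    (by filter_upwards [hG.isOpen.mem_nhds hp] with q hq using hG.herm q hq x y)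

theorem fderiv_I (w x y : E) :
    fderiv ℝ G p w (Complex.I • x) y = -fderiv ℝ G p w x (Complex.I • y) := by
  rw [← hG.fderiv_herm hp w x, Complex.I_smul_I_smul, map_neg, neg_neg]

theorem apply_I (x y : E) : G p (Complex.I • x) y = -G p x (Complex.I • y) := by
  rw [← hG.herm p hp x, Complex.I_smul_I_smul, map_neg, neg_neg]

variable [FiniteDimensional ℂ E]

/-- Positivity makes G p injective into a dual of the same dimension. This rules out the default
value 0 of `ContinuousLinearMap.inverse`, so the Christoffel maps really satisfy their defining
equations. -/
theorem isInvertible : (G p).IsInvertible := by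
  have hinj : Function.Injective (G p) := by
    refine (injective_iff_map_eq_zero (G p)).2 fun x hx => ?_
    by_contra h
    have := hG.pos p hp x h
    simp [hx] at this
  have hdim : Module.finrank ℝ E = Module.finrank ℝ (E →L[ℝ] ℝ) := by
    rw [← (LinearMap.toContinuousLinearMap (𝕜 := ℝ) (E := E) (F' := ℝ)).finrank_eq]
    exact (Subspace.dual_finrank_eq (K := ℝ) (V := E)).symm
  exact ⟨(LinearEquiv.ofInjectiveOfFinrankEq (G p : E →ₗ[ℝ] E →L[ℝ] ℝ) hinj
    hdim).toContinuousLinearEquiv, by ext; rfl⟩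

theorem apply_inverse (φ : E →L[ℝ] ℝ) : G p ((G p).inverse φ) = φ := by
  obtain ⟨e, he⟩ := hG.isInvertible hp
  rw [← he, ContinuousLinearMap.inverse_equiv]
  simp

theorem apply_bismut (x y z : E) : G p (bismut G p x y) z =
    (1 / 2 : ℝ) * (fderiv ℝ G p x y z + fderiv ℝ G p y x z - fderiv ℝ G p z x y)
      + (1 / 2 : ℝ) * dOmega G p (Complex.I • x) (Complex.I • y) (Complex.I • z) :=
  DFunLike.congr_fun (hG.apply_inverse hp (bismutForm G p x y)) z

theorem apply_chern (x y z : E) : G p (chern G p x y) z =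
    (1 / 2 : ℝ) * (fderiv ℝ G p x y z - fderiv ℝ G p (Complex.I • x) (Complex.I • y) z) :=
  DFunLike.congr_fun (hG.apply_inverse hp (chernForm G p x y)) z

omit [FiniteDimensional ℂ E] in
theorem ext_iff_apply {x y : E} : x = y ↔ ∀ z, G p x z = G p y z := by
  refine ⟨fun h z => by rw [h], fun h => ?_⟩
  by_contra hne
  have := hG.pos p hp (x - y) (sub_ne_zero.2 hne)
  simp [h] at this

omit [FiniteDimensional ℂ E] in
theorem fderiv_I_symm (w x y : E) :
    fderiv ℝ G p w y (Complex.I • x) = -fderiv ℝ G p w x (Complex.I • y) := by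
  rw [hG.fderiv_symm hp, hG.fderiv_I hp]

/-- The Bismut connection is metric. -/
theorem bismut_metric (x y z : E) :
    fderiv ℝ G p x y z = G p (bismut G p x y) z + G p y (bismut G p x z) := by
  rw [hG.symm p hp y, hG.apply_bismut hp, hG.apply_bismut hp]
  simp only [dOmega, Complex.I_smul_I_smul, map_neg, neg_apply]
  -- The claim is linear in the first derivatives of G; the only relations needed are that these
  -- derivatives are symmetric and J-invariant in the last two slots.
  linarith [hG.fderiv_symm hp x z y, hG.fderiv_symm hp y z x, hG.fderiv_symm hp z y x,
    hG.fderiv_symm hp (Complex.I • x) z y, hG.fderiv_symm hp (Complex.I • y) z x,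
    hG.fderiv_symm hp (Complex.I • z) y x, hG.fderiv_I_symm hp x y z, hG.fderiv_I_symm hp y x z,
    hG.fderiv_I_symm hp z x y, hG.fderiv_I_symm hp (Complex.I • x) y z,
    hG.fderiv_I_symm hp (Complex.I • y) x z, hG.fderiv_I_symm hp (Complex.I • z) x y]

/-- The Bismut connection preserves the complex structure. -/
theorem bismut_I (x y : E) : bismut G p x (Complex.I • y) = Complex.I • bismut G p x y := by
  rw [hG.ext_iff_apply hp]
  intro z
  rw [hG.apply_I hp, hG.apply_bismut hp, hG.apply_bismut hp]
  simp only [dOmega, Complex.I_smul_I_smul, map_neg, neg_apply, hG.fderiv_I hp]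
  linarith [hG.fderiv_symm hp x z y, hG.fderiv_symm hp y z x, hG.fderiv_symm hp z y x,
    hG.fderiv_symm hp (Complex.I • x) z y, hG.fderiv_symm hp (Complex.I • y) z x,
    hG.fderiv_symm hp (Complex.I • z) y x, hG.fderiv_I_symm hp x y z, hG.fderiv_I_symm hp y x z,
    hG.fderiv_I_symm hp z x y, hG.fderiv_I_symm hp (Complex.I • x) y z,
    hG.fderiv_I_symm hp (Complex.I • y) x z, hG.fderiv_I_symm hp (Complex.I • z) x y]

/-- The Levi-Civita part is symmetric in x and y and drops out, so only the 3-form part contributes.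
Hence T determines dω, and every symmetry of T can be read off from derivatives of G. -/
theorem torsion_bismut (x y z : E) : G p (torsion (bismut G) p x y) z =
    dOmega G p (Complex.I • x) (Complex.I • y) (Complex.I • z) := by
  simp only [torsion, sub_apply, ContinuousLinearMap.flip_apply, map_sub]
  rw [hG.apply_bismut hp, hG.apply_bismut hp]
  simp only [dOmega, Complex.I_smul_I_smul, map_neg, neg_apply]
  linarith [hG.fderiv_symm hp x z y, hG.fderiv_symm hp y z x, hG.fderiv_symm hp z y x,
    hG.fderiv_symm hp (Complex.I • x) z y, hG.fderiv_symm hp (Complex.I • y) z x,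
    hG.fderiv_symm hp (Complex.I • z) y x, hG.fderiv_I_symm hp x y z, hG.fderiv_I_symm hp y x z,
    hG.fderiv_I_symm hp z x y, hG.fderiv_I_symm hp (Complex.I • x) y z,
    hG.fderiv_I_symm hp (Complex.I • y) x z, hG.fderiv_I_symm hp (Complex.I • z) x y]

/-- The torsion of the Bismut connection is skew-symmetric in its first and last arguments. -/
theorem torsion_skew (x y z : E) : G p (torsion (bismut G) p x y) z =
    -G p (torsion (bismut G) p z y) x := by
  rw [hG.torsion_bismut hp, hG.torsion_bismut hp]
  simp only [dOmega, Complex.I_smul_I_smul, map_neg, neg_apply]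
  linarith [hG.fderiv_symm hp (Complex.I • x) (Complex.I • z) y,
    hG.fderiv_I hp (Complex.I • x) z y, hG.fderiv_symm hp (Complex.I • z) (Complex.I • x) y,
    hG.fderiv_I hp (Complex.I • z) x y, hG.fderiv_symm hp (Complex.I • y) (Complex.I • z) x,
    hG.fderiv_I hp (Complex.I • y) z x, hG.fderiv_symm hp (Complex.I • x) y z,
    hG.fderiv_symm hp (Complex.I • y) x z, hG.fderiv_I_symm hp (Complex.I • x) y z,
    hG.fderiv_I_symm hp (Complex.I • y) x z, hG.fderiv_I_symm hp (Complex.I • z) x y]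

/-- The torsion of the Bismut connection has no `(3,0)`-part. -/
theorem torsion_type (x y z : E) : G p (torsion (bismut G) p x y) z =
    G p (torsion (bismut G) p (Complex.I • x) (Complex.I • y)) z
      + G p (torsion (bismut G) p (Complex.I • x) y) (Complex.I • z)
      + G p (torsion (bismut G) p x (Complex.I • y)) (Complex.I • z) := by
  simp only [hG.torsion_bismut hp]
  simp only [dOmega, Complex.I_smul_I_smul, map_neg, neg_apply, neg_neg, smul_neg, hG.fderiv_I hp]
  linarith

omit hp in
theorem bismut_contDiffOn : ContDiffOn ℝ ∞ (bismut G) U := by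
  have hdG : ContDiffOn ℝ ∞ (fderiv ℝ G) U := hG.contDiffOn.fderiv_of_isOpen hG.isOpen (by simp)
  have hd : ∀ x y z, ContDiffOn ℝ ∞ (fun q => fderiv ℝ G q x y z) U := fun x y z =>
    ((hdG.clm_apply contDiffOn_const).clm_apply contDiffOn_const).clm_apply contDiffOn_const
  refine contDiffOn_clm_apply.2 fun x => contDiffOn_clm_apply.2 fun y => ?_
  have h1 : ContDiffOn ℝ ∞ (fun q => bismutForm G q x y) U := by
    refine contDiffOn_clm_apply.2 fun z => ?_
    simp only [bismutForm, dOmega, LinearMap.coe_toContinuousLinearMap', LinearMap.coe_mk,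
          AddHom.coe_mk]
    exact (contDiffOn_const.mul (((hd _ _ _).add (hd _ _ _)).sub (hd _ _ _))).add
      (contDiffOn_const.mul (((hd _ _ _).add (hd _ _ _)).add (hd _ _ _)))
  have h2 : ContDiffOn ℝ ∞ (fun q => (G q).inverse) U := fun q hq =>
    (hG.isInvertible hq).contDiffAt_map_inverse.comp_contDiffWithinAt q (hG.contDiffOn q hq)
  exact h2.clm_apply h1

omit hp in
theorem curvature_contDiffOn : ContDiffOn ℝ ∞ (curvature (bismut G)) U := by
  have hΓ := hG.bismut_contDiffOn
  have hdΓ : ContDiffOn ℝ ∞ (fderiv ℝ (bismut G)) U := hΓ.fderiv_of_isOpen hG.isOpen (by simp)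
  refine contDiffOn_clm_apply.2 fun x => contDiffOn_clm_apply.2 fun y =>
    contDiffOn_clm_apply.2 fun z => ?_
  simp only [curvature_apply]
  have h : ∀ x y, ContDiffOn ℝ ∞ (fun q => bismut G q x y) U := fun x y =>
    (hΓ.clm_apply contDiffOn_const).clm_apply contDiffOn_const
  have hd : ∀ x y z, ContDiffOn ℝ ∞ (fun q => fderiv ℝ (bismut G) q x y z) U := fun x y z =>
    ((hdΓ.clm_apply contDiffOn_const).clm_apply contDiffOn_const).clm_apply contDiffOn_const
  exact (((hd _ _ _).sub (hd _ _ _)).add ((hΓ.clm_apply contDiffOn_const).clm_apply (h _ _))).sub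
    ((hΓ.clm_apply contDiffOn_const).clm_apply (h _ _))

omit hp in
theorem torsion_contDiffOn : ContDiffOn ℝ ∞ (torsion (bismut G)) U :=
  hG.bismut_contDiffOn.sub
    ((ContinuousLinearMap.flipₗᵢ ℝ E E E).contDiff.comp_contDiffOn hG.bismut_contDiffOn)

theorem hasLineDerivAt_bismut (v : E) :
    HasLineDerivAt ℝ (bismut G) (fderiv ℝ (bismut G) p v) p v :=
  hasLineDerivAt_fderiv ((hG.bismut_contDiffOn.differentiableOn (by simp) p hp).differentiableAt
    (hG.isOpen.mem_nhds hp)) v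

/-- The curvature of the Bismut connection is complex linear. -/
theorem curvature_I (v w y : E) : curvature (bismut G) p v w (Complex.I • y) =
    Complex.I • curvature (bismut G) p v w y := by
  have key : ∀ v w, fderiv ℝ (bismut G) p v w (Complex.I • y) =
      (Complex.I • ContinuousLinearMap.id ℝ E : E →L[ℝ] E) (fderiv ℝ (bismut G) p v w y) :=
    fun v w => by
      have h := hG.hasLineDerivAt_bismut hp v
      have hI : HasLineDerivAt ℝ (fun _ : E => (Complex.I • ContinuousLinearMap.id ℝ E : E →L[ℝ] E))
        0 p v := hasDerivAt_const (0 : ℝ) _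
      simpa using ((h.clm_const w).clm_const (Complex.I • y)).eq_of_eventuallyEq
        (hI.clm_apply₁ ((h.clm_const w).clm_const y))
        (by filter_upwards [hG.isOpen.mem_nhds hp] with q hq using hG.bismut_I hq w y)
  simp only [curvature_apply, key, hG.bismut_I hp, smul_apply, ContinuousLinearMap.id_apply,
    smul_sub, smul_add]

/-- The curvature of the Bismut connection is skew-adjoint. -/
theorem curvature_skew (v w y z : E) : G p (curvature (bismut G) p v w y) z =
    -G p (curvature (bismut G) p v w z) y := by
  have hn := hG.isOpen.mem_nhds hp
  have dG := hG.hasLineDerivAt hp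
  have dΓ := hG.hasLineDerivAt_bismut hp
  have hdG : ContDiffOn ℝ ∞ (fderiv ℝ G) U := hG.contDiffOn.fderiv_of_isOpen hG.isOpen (by simp)
  have dD : ∀ v, HasLineDerivAt ℝ (fderiv ℝ G) (fderiv ℝ (fderiv ℝ G) p v) p v :=
    hasLineDerivAt_fderiv ((hdG.differentiableOn (by simp) p hp).differentiableAt hn)
  have key : ∀ v w, fderiv ℝ (fderiv ℝ G) p v w y z = _ := fun v w =>
    (((dD v).clm_const w).clm_const y).clm_const z |>.eq_of_eventuallyEq
      ((((dG v).clm_apply₁ (((dΓ v).clm_const w).clm_const y)).clm_const z).add₁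
        (((dG v).clm_const y).clm_apply₁ (((dΓ v).clm_const w).clm_const z)))
      (by filter_upwards [hn] with q hq using hG.bismut_metric hq w y z)
  have hsymm : fderiv ℝ (fderiv ℝ G) p v w = fderiv ℝ (fderiv ℝ G) p w v :=
    ((hG.contDiffOn.contDiffAt hn).isSymmSndFDerivAt
      (by simpa using WithTop.coe_le_coe.2 (le_top : (2 : ℕ∞) ≤ ⊤))) v w
  have e := congrArg (fun L => L y z) hsymm
  simp only [key, add_apply, hG.bismut_metric hp] at e
  rw [hG.symm p hp _ y]
  simp only [curvature_apply, map_add, map_sub, add_apply, sub_apply]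
  linarith

theorem bismut_bianchi (h : TorsionParallelAt (bismut G) p) (x y z : E) :
    curvature (bismut G) p x y z + curvature (bismut G) p y z x + curvature (bismut G) p z x y
      = torsion (bismut G) p (torsion (bismut G) p x y) z
        + torsion (bismut G) p (torsion (bismut G) p y z) x
        + torsion (bismut G) p (torsion (bismut G) p z x) y :=
  bianchi ((hG.bismut_contDiffOn.differentiableOn (by simp) p hp).differentiableAt
    (hG.isOpen.mem_nhds hp)) h x y z

omit hG hp in
theorem _root_.HermitianLocal.curvature_swap {V : Type*} [NormedAddCommGroup V] [NormedSpace ℝ V]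
    (Γ : V → V →L[ℝ] V →L[ℝ] V) (p x y z : V) : curvature Γ p x y z = -curvature Γ p y x z := by
  simp only [curvature_apply]; abel

omit hG hp in
theorem _root_.HermitianLocal.torsion_swap {V : Type*} [NormedAddCommGroup V] [NormedSpace ℝ V]
    (Γ : V → V →L[ℝ] V →L[ℝ] V) (p x y : V) : torsion Γ p x y = -torsion Γ p y x := by
  simp [torsion]

/-- The curvature of a Bismut connection with parallel torsion is symmetric under exchange of
the two pairs of arguments. -/
theorem curvature_pair (h : TorsionParallelAt (bismut G) p) (x y z w : E) :
    G p (curvature (bismut G) p x y z) w = G p (curvature (bismut G) p z w x) y := by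
  have b : ∀ x y z w : E, _ := fun x y z w => congrArg (fun u => G p u w)
    (hG.bismut_bianchi hp h x y z)
  -- Total skewness turns each torsion term of the Bianchi identity into an inner product of two
  -- torsions; their cyclic sum is alternating in all four arguments.
  have t1 : ∀ x y z w : E, G p (torsion (bismut G) p (torsion (bismut G) p x y) z) w =
      G p (torsion (bismut G) p z w) (torsion (bismut G) p x y) := fun x y z w => by
    rw [hG.torsion_skew hp, torsion_swap _ _ w z]; simp
  have t2 : ∀ x y z w : E, G p (torsion (bismut G) p x y) (torsion (bismut G) p z w) =
      -G p (torsion (bismut G) p y x) (torsion (bismut G) p z w) := fun x y z w => by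
    rw [torsion_swap _ _ x y]; simp
  have t3 : ∀ x y z w : E, G p (torsion (bismut G) p x y) (torsion (bismut G) p z w) =
      G p (torsion (bismut G) p z w) (torsion (bismut G) p x y) := fun x y z w => hG.symm p hp _ _
  have r1 : ∀ x y z w : E, G p (curvature (bismut G) p x y z) w =
      -G p (curvature (bismut G) p y x z) w := fun x y z w => by
    rw [curvature_swap]; simp
  simp only [map_add, add_apply, t1] at b
  -- The octahedron argument: the four Bianchi identities, taken with signs +, +, −, −. The
  -- alternating torsion sides change sign under each cyclic shift and cancel.
  linarith [b x y z w, b y z w x, b z w x y, b w x y z, hG.curvature_skew hp x y z w,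
    hG.curvature_skew hp y z x w, hG.curvature_skew hp z x y w, hG.curvature_skew hp z w x y,
    hG.curvature_skew hp w x y z, hG.curvature_skew hp x z w y, hG.curvature_skew hp y w z x,
    hG.curvature_skew hp w y z x, hG.curvature_skew hp x z y w,
    r1 x z y w, r1 x z w y, r1 y w x z, r1 y w z x, r1 x w y z, r1 x w z y, r1 y z x w, r1 y z w x,
    r1 x y z w, r1 x y w z, r1 z w x y, r1 z w y x,
    t2 x y z w, t2 x y w z, t2 z w x y, t2 z w y x, t2 x z y w, t2 x z w y, t2 y w x z, t2 y w z x,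
    t2 x w y z, t2 x w z y, t2 y z x w, t2 y z w x,
    t3 x y z w, t3 x y w z, t3 y x w z, t3 y x z w, t3 x z y w, t3 x z w y, t3 z x w y, t3 z x y w,
    t3 x w y z, t3 x w z y, t3 w x y z, t3 w x z y]

end IsHermitianMetricOn

end Metric

end HermitianLocal

namespace HermitianLocal

/-! ### Traces in an orthonormal basis and the identity 3|ξ|² = 2|T|² -/

namespace IsHermitianMetricOn

variable {E : Type*} [NormedAddCommGroup E] [NormedSpace ℂ E]
  {G : E → E →L[ℝ] E →L[ℝ] ℝ} {U : Set E} (hG : IsHermitianMetricOn G U)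
  {p : E} (hp : p ∈ U) {ι : Type*} [Fintype ι] [DecidableEq ι] {e : Module.Basis ι ℝ E}
  (he : ∀ i j, G p (e i) (e j) = if i = j then 1 else 0)

include hG hp in
-- Orthonormality is with respect to G p, which is unrelated to the norm of E. Hence an orthogonal
-- basis of the bilinear form is taken and rescaled.
theorem exists_orthonormal_basis [FiniteDimensional ℂ E] :
    ∃ e : Module.Basis (Fin (Module.finrank ℝ E)) ℝ E,
      ∀ i j, G p (e i) (e j) = if i = j then 1 else 0 := by
  let B : LinearMap.BilinForm ℝ E :=
    LinearMap.mk₂ ℝ (fun x y => G p x y) (by simp) (by simp) (by simp) (by simp)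
  have hB : ∀ x y, B x y = G p x y := fun _ _ => rfl
  have hBs : LinearMap.IsSymm B := ⟨fun x y => by simp [hB, hG.symm p hp x y]⟩
  obtain ⟨v, hv⟩ := LinearMap.BilinForm.exists_orthogonal_basis (K := ℝ) (V := E) hBs
  have hpos : ∀ i, 0 < G p (v i) (v i) := fun i => hG.pos p hp _ (v.ne_zero i)
  have hu : ∀ i, IsUnit ((√(G p (v i) (v i)))⁻¹) := fun i =>
    (inv_ne_zero (Real.sqrt_ne_zero'.2 (hpos i))).isUnit
  refine ⟨v.isUnitSMul hu, fun i j => ?_⟩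
  simp only [Module.Basis.isUnitSMul_apply, map_smul, smul_apply, smul_eq_mul]
  split_ifs with h
  · subst h
    have := Real.mul_self_sqrt (hpos i).le
    have h0 : √(G p (v i) (v i)) ≠ 0 := Real.sqrt_ne_zero'.2 (hpos i)
    field_simp
    rw [sq, this]
  · have : G p (v i) (v j) = 0 := hv h
    simp [this]

include he in
theorem repr_eq (x : E) (i : ι) : e.repr x i = G p x (e i) := by
  conv_rhs => rw [← e.sum_repr x]
  simp only [map_sum, map_smul, sum_apply, smul_apply, he]
  simp

include he in
theorem sum_apply_smul (x : E) : ∑ i, G p x (e i) • e i = x := by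
  conv_rhs => rw [← e.sum_repr x]
  simp only [repr_eq he]

include he in
theorem trace_eq (f : E →ₗ[ℝ] E) : LinearMap.trace ℝ E f = ∑ i, G p (f (e i)) (e i) := by
  rw [LinearMap.trace_eq_matrix_trace ℝ e, Matrix.trace]
  simp [LinearMap.toMatrix_apply, repr_eq he]

include he in
theorem apply_eq_sum (x y : E) : G p x y = ∑ i, G p x (e i) * G p y (e i) := by
  conv_lhs => rw [← sum_apply_smul he y]
  simp [mul_comm]

include hG hp he in
/-- A trace over an orthonormal basis does not change if the complex structure is applied to
the basis. -/
theorem sum_I_smul {F : Type*} [AddCommGroup F] [Module ℝ F] (B : E →ₗ[ℝ] E →ₗ[ℝ] F) :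
    ∑ i, B (Complex.I • e i) (Complex.I • e i) = ∑ i, B (e i) (e i) := by
  have h1 : ∀ x : E, B x x = ∑ k, ∑ l, (G p x (e k) * G p x (e l)) • B (e k) (e l) := fun x => by
    conv_lhs => rw [← sum_apply_smul he x]
    simp only [map_sum, map_smul, LinearMap.sum_apply, LinearMap.smul_apply, Finset.smul_sum,
      smul_smul]
    rw [Finset.sum_comm]
    exact Finset.sum_congr rfl fun k _ => Finset.sum_congr rfl fun l _ => by rw [mul_comm]
  simp only [h1 (Complex.I • _)]
  rw [Finset.sum_comm]
  refine Finset.sum_congr rfl fun k _ => ?_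
  rw [Finset.sum_comm]
  have h2 : ∀ l, ∑ i, (G p (Complex.I • e i) (e k) * G p (Complex.I • e i) (e l)) =
      if k = l then 1 else 0 := fun l => by
    have : ∀ i m, G p (Complex.I • e i) (e m) = -G p (Complex.I • e m) (e i) := fun i m => by
      rw [hG.apply_I hp, hG.symm p hp]
    simp only [this _ k, this _ l, neg_mul_neg, ← apply_eq_sum he, hG.herm p hp, he]
  simp only [← Finset.sum_smul, h2]
  simp

section

variable [FiniteDimensional ℂ E]

include hG hp he

/-- The torsion 1-form as a contraction of the torsion of the Bismut connection. -/
theorem sum_torsion_I (x : E) :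
    ∑ i, G p (torsion (bismut G) p (e i) (Complex.I • e i)) x =
      -2 * torsionOneForm G p (Complex.I • x) := by
  -- Rotating the basis by J identifies ∑ (D_{e_i} G)(e_i, J x) with ∑ (D_{J e_i} G)(e_i, x), the
  -- two divergence terms that occur in both traces.
  have s1 := sum_I_smul hG hp he (LinearMap.mk₂ ℝ
    (fun u v => fderiv ℝ G p (Complex.I • u) v x) (by simp) (by simp [smul_comm Complex.I])
    (by simp) (by simp))
  simp only [LinearMap.mk₂_apply, Complex.I_smul_I_smul, map_neg, neg_apply, hG.fderiv_I hp] at s1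
  have h1 : ∀ i, G p (torsion (bismut G) p (e i) (Complex.I • e i)) x =
      fderiv ℝ G p (Complex.I • x) (e i) (e i) - fderiv ℝ G p (e i) (e i) (Complex.I • x)
        - fderiv ℝ G p (Complex.I • e i) (e i) x := fun i => by
    rw [hG.torsion_bismut hp]
    simp only [dOmega, Complex.I_smul_I_smul, map_neg, neg_apply, hG.fderiv_I hp]
    linarith [hG.fderiv_I_symm hp (e i) (e i) x]
  have h2 : ∀ i, G p (torsion (chern G) p (e i) (Complex.I • x)) (e i) =
      (1 / 2) * fderiv ℝ G p (e i) (e i) (Complex.I • x)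
        - (1 / 2) * fderiv ℝ G p (Complex.I • x) (e i) (e i)
        + (1 / 2) * fderiv ℝ G p (Complex.I • e i) (e i) x := fun i => by
    simp only [torsion, sub_apply, ContinuousLinearMap.flip_apply, map_sub]
    rw [hG.apply_chern hp, hG.apply_chern hp]
    simp only [Complex.I_smul_I_smul, map_neg, neg_apply, hG.fderiv_I hp]
    linarith [hG.fderiv_I_symm hp x (e i) (e i), hG.fderiv_I_symm hp (e i) x (e i),
      hG.fderiv_symm hp (Complex.I • e i) x (e i), hG.fderiv_symm hp (e i) (Complex.I • x) (e i),
      hG.fderiv_I_symm hp (e i) (e i) x]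
  have h3 : torsionOneForm G p (Complex.I • x) =
      ∑ i, G p (torsion (chern G) p (e i) (Complex.I • x)) (e i) := trace_eq he _
  simp only [neg_neg] at s1
  simp only [h3, h1, h2, Finset.sum_add_distrib, Finset.sum_sub_distrib, ← Finset.mul_sum, ← s1]
  ring

omit hG hp he in
omit [Fintype ι] [DecidableEq ι] [FiniteDimensional ℂ E] in
-- This is the imaginary part of Ric¹. It carries all the information for a metric connection, since
-- a skew-adjoint R(x, y) has real trace zero.
theorem _root_.HermitianLocal.trace_I_smul_curvature {Γ : E → E →L[ℝ] E →L[ℝ] E} {p x y : E}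
    (h : ricciFirst Γ p x y = 0) :
    LinearMap.trace ℝ E ((Complex.I • curvature Γ p x y : E →L[ℝ] E) : E →ₗ[ℝ] E) = 0 := by
  simpa [ricciFirst] using congrArg Complex.im h

/-- The squared norm of the trace of the torsion, for a connection with vanishing first and third
Ricci curvature, in terms of the squared norm of the torsion. -/
theorem norm_sum_torsion_I (h : TorsionParallelAt (bismut G) p)
    (h1 : ∀ x y, ricciFirst (bismut G) p x y = 0) (h3 : ∀ x y, ricciThird (bismut G) p x y = 0)
    {ξ : E} (hξ : ξ = ∑ i, torsion (bismut G) p (e i) (Complex.I • e i)) :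
    3 * G p ξ ξ = 2 * ∑ i, ∑ j, ∑ k, G p (torsion (bismut G) p (e i) (e j)) (e k) ^ 2 := by
  set T := torsion (bismut G) p with hT
  set R := curvature (bismut G) p with hR
  have hs : ∀ x y, T x y = -T y x := torsion_swap _ _
  have hsk : ∀ x y z, G p (T x y) z = -G p (T z y) x := hG.torsion_skew hp
  have hsk' : ∀ x y z, G p (T x y) z = -G p (T x z) y := fun x y z => by
    rw [hs x y, map_neg, neg_apply, hsk, hs z x]; simp
  -- Let Q be the double sum on the right. `torsion_type` splits one factor of |T|² into three terms
  -- with J in two of the three slots, and total skewness makes each of them sum to Q.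
  have hX : ∑ i, ∑ j, ∑ k, G p (T (e i) (e j)) (e k) ^ 2 =
      3 * ∑ i, ∑ j, G p (T (Complex.I • e i) (Complex.I • e j)) (T (e i) (e j)) := by
    have a0 : ∀ i j, G p (T (Complex.I • e i) (Complex.I • e j)) (T (e i) (e j)) =
        ∑ k, G p (T (Complex.I • e i) (Complex.I • e j)) (e k) * G p (T (e i) (e j)) (e k) :=
      fun i j => apply_eq_sum he _ _
    have a1 : ∑ i, ∑ j, ∑ k, G p (T (Complex.I • e i) (e j)) (Complex.I • e k)
        * G p (T (e i) (e j)) (e k) =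
        ∑ i, ∑ j, G p (T (Complex.I • e i) (Complex.I • e j)) (T (e i) (e j)) := by
      simp only [a0]
      refine Finset.sum_congr rfl fun i _ => ?_
      rw [Finset.sum_comm]
      refine Finset.sum_congr rfl fun j _ => Finset.sum_congr rfl fun k _ => ?_
      rw [hsk' _ (e k) (Complex.I • e j), hsk' _ (e k) (e j), neg_mul_neg]
    have a2 : ∑ i, ∑ j, ∑ k, G p (T (e i) (Complex.I • e j)) (Complex.I • e k)
        * G p (T (e i) (e j)) (e k) =
        ∑ i, ∑ j, G p (T (Complex.I • e i) (Complex.I • e j)) (T (e i) (e j)) := by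
      rw [← a1, Finset.sum_comm]
      refine Finset.sum_congr rfl fun j _ => Finset.sum_congr rfl fun i _ =>
        Finset.sum_congr rfl fun k _ => ?_
      rw [hs (e i), hs (e i) (e j)]
      simp only [map_neg, neg_apply, neg_mul_neg]
    have a3 : ∀ i j k, G p (T (e i) (e j)) (e k) ^ 2 =
        G p (T (Complex.I • e i) (Complex.I • e j)) (e k) * G p (T (e i) (e j)) (e k)
        + G p (T (Complex.I • e i) (e j)) (Complex.I • e k) * G p (T (e i) (e j)) (e k)
        + G p (T (e i) (Complex.I • e j)) (Complex.I • e k) * G p (T (e i) (e j)) (e k) :=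
      fun i j k => by
        rw [sq]
        nth_rw 1 [hT, hG.torsion_type hp (e i) (e j) (e k)]
        ring
    simp only [a3, Finset.sum_add_distrib, a1, a2, ← a0]
    ring
  have hR1 : ∀ x y, ∑ j, G p (R x y (e j)) (Complex.I • e j) = 0 := fun x y => by
    have h2 := trace_I_smul_curvature (h1 x y)
    rw [← hR] at h2
    rw [trace_eq he] at h2
    have h4 : ∀ j, G p (((Complex.I • R x y : E →L[ℝ] E) : E →ₗ[ℝ] E) (e j)) (e j) =
        -G p (R x y (e j)) (Complex.I • e j) := fun j => hG.apply_I hp _ _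
    simpa only [h4, Finset.sum_neg_distrib, neg_eq_zero] using h2
  have hR3 : ∀ x y, ∑ i, G p (R (e i) x y) (e i) = 0 := fun x y => by
    rw [← h3 x y, ricciThird, trace_eq he]; rfl
  have c1 : ∀ i j, G p (R (e i) (Complex.I • e i) (e j)) (Complex.I • e j)
      + G p (R (Complex.I • e i) (e j) (e i)) (Complex.I • e j)
      + G p (R (e j) (e i) (Complex.I • e i)) (Complex.I • e j) = _ := fun i j => by
    have := congrArg (fun u => G p u (Complex.I • e j))
      (hG.bismut_bianchi hp h (e i) (Complex.I • e i) (e j))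
    simpa only [map_add, add_apply] using this
  -- The first term is a trace of J ∘ R(e_i, J e_i), zero by Ric¹. In the other two, R commutes with
  -- J and is skew, and rotating the basis by J where necessary turns the sum over i into Ric³.
  have c2 : ∑ j, ∑ i, (G p (R (e i) (Complex.I • e i) (e j)) (Complex.I • e j)
      + G p (R (Complex.I • e i) (e j) (e i)) (Complex.I • e j)
      + G p (R (e j) (e i) (Complex.I • e i)) (Complex.I • e j)) = 0 := by
    simp only [Finset.sum_add_distrib]
    have d1 : ∑ j, ∑ i, G p (R (e i) (Complex.I • e i) (e j)) (Complex.I • e j) = 0 := by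
      rw [Finset.sum_comm]; simp only [hR1, Finset.sum_const_zero]
    have d2 : ∀ j, ∑ i, G p (R (Complex.I • e i) (e j) (e i)) (Complex.I • e j) = 0 := fun j => by
      have := sum_I_smul hG hp he (LinearMap.mk₂ ℝ
        (fun u v => G p (R u (e j) (e j)) v) (by simp) (by simp) (by simp) (by simp))
      simp only [LinearMap.mk₂_apply, hR3] at this
      rw [← this]
      refine Finset.sum_congr rfl fun i _ => ?_
      rw [hG.curvature_skew hp, hR, hG.curvature_I hp, hG.apply_I hp, neg_neg]
    have d3 : ∀ j, ∑ i, G p (R (e j) (e i) (Complex.I • e i)) (Complex.I • e j) = 0 := fun j => by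
      rw [← hR3 (e j) (e j)]
      refine Finset.sum_congr rfl fun i _ => ?_
      rw [hR, hG.curvature_I hp, hG.herm p hp, curvature_swap, map_neg, neg_apply,
        hG.curvature_skew hp, neg_neg]
    simp only [d1, d2, d3, Finset.sum_const_zero, add_zero]
  have c3 : ∑ i, ∑ j, G p (T (T (e i) (Complex.I • e i)) (e j)) (Complex.I • e j) = G p ξ ξ := by
    rw [hξ]
    simp only [map_sum, sum_apply]
    rw [Finset.sum_comm]
    refine Finset.sum_congr rfl fun j _ => Finset.sum_congr rfl fun i _ => ?_
    rw [hsk, hs, map_neg, neg_apply, neg_neg, hG.symm p hp]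
  have c4 : ∑ i, ∑ j, G p (T (T (Complex.I • e i) (e j)) (e i)) (Complex.I • e j) =
      -∑ i, ∑ j, G p (T (Complex.I • e i) (Complex.I • e j)) (T (e i) (e j)) := by
    rw [← Finset.sum_neg_distrib]
    refine Finset.sum_congr rfl fun i _ => ?_
    have := sum_I_smul hG hp he (LinearMap.mk₂ ℝ
        (fun u v => G p (T (T (Complex.I • e i) u) (e i)) (Complex.I • v)) (by simp) (by simp)
        (by simp) (by simp [smul_comm Complex.I]))
    simp only [LinearMap.mk₂_apply] at this
    rw [← this, ← Finset.sum_neg_distrib]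
    refine Finset.sum_congr rfl fun j _ => ?_
    rw [Complex.I_smul_I_smul, map_neg, hsk, hs, map_neg, neg_apply, neg_neg, hG.symm p hp]
  have c5 : ∑ i, ∑ j, G p (T (T (e j) (e i)) (Complex.I • e i)) (Complex.I • e j) =
      -∑ i, ∑ j, G p (T (Complex.I • e i) (Complex.I • e j)) (T (e i) (e j)) := by
    simp only [← Finset.sum_neg_distrib]
    refine Finset.sum_congr rfl fun i _ => Finset.sum_congr rfl fun j _ => ?_
    rw [hsk, hs, hs (e j)]
    simp
  -- What is left of the contracted Bianchi identity is |ξ|² − 2Q = 0, to be compared with |T|² =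
  -- 3Q.
  rw [Finset.sum_comm] at c2
  simp only [c1, ← hT, Finset.sum_add_distrib, c3, c4, c5] at c2
  rw [hX]
  linarith

end

end IsHermitianMetricOn

end HermitianLocal

/-! ### Algebra of Ricci-flat parallel curvature tensors via the curvature operator -/

namespace CurvatureTensor

variable {ι : Type*} [Fintype ι] [DecidableEq ι]

omit [Fintype ι] [DecidableEq ι] in
theorem sum_rotate {α β γ : Type*} [Fintype α] [Fintype β] [Fintype γ] (f : α → β → γ → ℝ) :
    ∑ i, ∑ a, ∑ c, f i a c = ∑ a, ∑ c, ∑ i, f i a c := by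
  rw [Finset.sum_comm]
  exact Finset.sum_congr rfl fun a _ => Finset.sum_comm

omit [Fintype ι] [DecidableEq ι] in
theorem sum_reverse {α β γ : Type*} [Fintype α] [Fintype β] [Fintype γ] (f : α → β → γ → ℝ) :
    ∑ i, ∑ a, ∑ c, f i a c = ∑ c, ∑ a, ∑ i, f i a c := by
  rw [sum_rotate, Finset.sum_comm]

open Matrix in
-- Half the coefficient of s²t² in the hypothesis. It is isolated by adding the cases (1, 1) and (1,
-- −1) and subtracting the pure fourth-power cases (1, 0) and (0, 1).
theorem trace_polarization {X Y : Matrix ι ι ℝ}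
    (h : ∀ s t : ℝ, 4 * trace ((s • X + t • Y) ^ 4) = trace ((s • X + t • Y) ^ 2) ^ 2) :
    8 * trace (X * X * (Y * Y)) + 4 * trace (X * Y * X * Y) =
      trace (X * X) * trace (Y * Y) + 2 * trace (X * Y) ^ 2 := by
  have h1 := h 1 1
  have h2 := h 1 (-1)
  have h3 := h 1 0
  have h4 := h 0 1
  simp only [one_smul, neg_smul, zero_smul, add_zero, zero_add, ← sub_eq_add_neg] at h1 h2 h3 h4
  have e1 : (X + Y) ^ 2 = X * X + X * Y + Y * X + Y * Y := by noncomm_ring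
  have e2 : (X - Y) ^ 2 = X * X - X * Y - Y * X + Y * Y := by noncomm_ring
  have e3 : (X + Y) ^ 4 + (X - Y) ^ 4 = (2 : ℝ) • (X ^ 4 + Y ^ 4 + X * X * (Y * Y) + X * Y * Y * X
      + Y * Y * (X * X) + Y * (X * X * Y) + X * Y * X * Y + Y * (X * Y * X)) := by
    rw [two_smul]; noncomm_ring
  have e4 := congrArg trace e3
  simp only [trace_add, trace_smul, smul_eq_mul] at e4
  rw [trace_mul_comm (X * Y * Y) X, trace_mul_comm (Y * Y) (X * X), trace_mul_comm Y (X * X * Y),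
    trace_mul_comm Y (X * Y * X), ← mul_assoc X (X * Y) Y, ← mul_assoc X X Y, mul_assoc (X * X) Y Y]
    at e4
  simp only [e1, e2, trace_add, trace_sub, trace_mul_comm Y X, sq X, sq Y] at h1 h2 h3 h4
  linarith

omit [DecidableEq ι] in
theorem trace_sq_nonpos {K : Matrix ι ι ℝ} (h : K.transpose = -K) :
    Matrix.trace (K * K) ≤ 0 := by
  have : Matrix.trace (K * K) = -Matrix.trace (K * K.transpose) := by
    rw [h, mul_neg, Matrix.trace_neg, neg_neg]
  rw [this, neg_nonpos]
  simp only [Matrix.trace, Matrix.diag, Matrix.mul_apply, Matrix.transpose_apply]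
  exact Finset.sum_nonneg fun i _ => Finset.sum_nonneg fun j _ => mul_self_nonneg _

/-- The algebraic curvature tensor of a metric connection with parallel curvature, with vanishing
Ricci tensor. -/
structure IsParallelRicciFlat (r : ι → ι → ι → ι → ℝ) : Prop where
  skew : ∀ i j k l, r i j k l = -r i j l k
  pair : ∀ i j k l, r i j k l = r k l i j
  ricci : ∀ j k, ∑ i, r i j k i = 0
  -- R(u, v) acts on R as a derivation with result zero; the left side is the commutator of R(u, v)
  -- and R(x, y).
  parallel : ∀ u v x y k l, ∑ m, r x y k m * r u v m l - ∑ m, r u v k m * r x y m l =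
    ∑ m, r u v x m * r m y k l + ∑ m, r u v y m * r x m k l

variable {r : ι → ι → ι → ι → ℝ}

/-- The spectral decomposition of the curvature operator. -/
theorem exists_spectral (hr : ∀ i j k l, r i j k l = r k l i j) :
    ∃ (μ : ι × ι → ℝ) (A : ι × ι → Matrix ι ι ℝ),
      (∀ a k l, ∑ i, ∑ j, A a i j * r i j k l = μ a * A a k l) ∧
      (∀ a b, ∑ i, ∑ j, A a i j * A b i j = if a = b then 1 else 0) ∧
      (∀ i j k l, r i j k l = ∑ a, μ a * A a i j * A a k l) := by
  -- By pair symmetry R is a symmetric operator on all 2-tensors, not only the skew ones. Its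
  -- eigenbasis may therefore contain tensors that are not skew, but only with eigenvalue 0.
  let N : Matrix (ι × ι) (ι × ι) ℝ := Matrix.of fun s t => r s.1 s.2 t.1 t.2
  have hN : N.IsHermitian := by
    ext s t; simp [N, hr t.1]
  refine ⟨hN.eigenvalues, fun a => Matrix.of fun i j => hN.eigenvectorBasis a (i, j), ?_, ?_, ?_⟩
  · intro a k l
    have := congrFun (hN.mulVec_eigenvectorBasis a) (k, l)
    simp only [Matrix.mulVec, dotProduct, Fintype.sum_prod_type, N, Matrix.of_apply] at this
    simp only [Matrix.of_apply]
    rw [← smul_eq_mul]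
    refine Eq.trans (Finset.sum_congr rfl fun i _ => Finset.sum_congr rfl fun j _ => ?_) this
    rw [mul_comm, hr]
  · intro a b
    have := orthonormal_iff_ite.1 hN.eigenvectorBasis.orthonormal b a
    simp only [PiLp.inner_apply, Fintype.sum_prod_type] at this
    simpa [eq_comm] using this
  · intro i j k l
    have h := congrFun (congrFun hN.spectral_theorem (i, j)) (k, l)
    rw [Unitary.conjStarAlgAut_apply, Matrix.mul_apply] at h
    simp only [Matrix.mul_diagonal, Matrix.star_apply, Matrix.IsHermitian.eigenvectorUnitary_apply,
      Function.comp_apply] at h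
    refine h.trans (Finset.sum_congr rfl fun a _ => ?_)
    simp [mul_comm, mul_left_comm]

section

variable {μ : ι × ι → ℝ} {A : ι × ι → Matrix ι ι ℝ}
  (hA : ∀ a k l, ∑ i, ∑ j, A a i j * r i j k l = μ a * A a k l)
  (hA' : ∀ i j k l, r i j k l = ∑ a, μ a * A a i j * A a k l)
include hA

omit [DecidableEq ι] in
-- An eigenvector with nonzero eigenvalue is thereby a combination of curvature endomorphisms and
-- inherits their linear properties.
theorem smul_eq_sum (a : ι × ι) :
    μ a • A a = ∑ i, ∑ j, A a i j • Matrix.of fun k l => r i j k l := by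
  ext k l
  simp [Matrix.sum_apply, hA]

omit [DecidableEq ι] in
theorem skew_of_ne_zero (hr : IsParallelRicciFlat r) {a : ι × ι} (ha : μ a ≠ 0) (k l : ι) :
    A a k l = -A a l k := by
  refine mul_left_cancel₀ ha ?_
  rw [mul_neg, ← hA, ← hA, ← Finset.sum_neg_distrib]
  refine Finset.sum_congr rfl fun i _ => ?_
  rw [← Finset.sum_neg_distrib]
  exact Finset.sum_congr rfl fun j _ => by rw [hr.skew, mul_neg]

omit [DecidableEq ι] in
/-- The bracket of eigenvectors of the curvature operator is an eigenvector. -/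
theorem bracket_eigenvector (hr : IsParallelRicciFlat r) {a c : ι × ι} (ha : μ a ≠ 0) (k l : ι) :
    ∑ x, ∑ y, (A c * A a - A a * A c) x y * r x y k l = μ c * (A c * A a - A a * A c) k l := by
  -- The identity R·R = 0 contracted with A_a in the pair (u, v). Dividing by μ_a says that A_a acts
  -- on R with result zero; contracting (x, y) with A_c then gives the claim.
  have h1 : ∀ x y, ∑ m, r x y k m * (μ a * A a m l) - ∑ m, μ a * A a k m * r x y m l =
      ∑ m, μ a * A a x m * r m y k l + ∑ m, μ a * A a y m * r x m k l := fun x y => by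
    simp only [← hA, Finset.mul_sum, Finset.sum_mul]
    simp only [← Finset.sum_add_distrib, ← Finset.sum_sub_distrib]
    refine (sum_rotate _).trans (Eq.trans ?_ (sum_rotate _).symm)
    refine Finset.sum_congr rfl fun u _ => Finset.sum_congr rfl fun v _ => ?_
    have := congrArg (fun t => A a u v * t) (hr.parallel u v x y k l)
    simp only [← Finset.sum_add_distrib, ← Finset.sum_sub_distrib, Finset.mul_sum] at this
    refine Eq.trans (Finset.sum_congr rfl fun m _ => ?_)
      (this.trans (Finset.sum_congr rfl fun m _ => ?_)) <;> ring
  have h2 : ∀ x y, ∑ m, r x y k m * A a m l - ∑ m, A a k m * r x y m l =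
      ∑ m, A a x m * r m y k l + ∑ m, A a y m * r x m k l := fun x y => by
    refine mul_left_cancel₀ ha ?_
    have h := h1 x y
    simp only [← Finset.sum_add_distrib, ← Finset.sum_sub_distrib] at h ⊢
    rw [Finset.mul_sum, Finset.mul_sum]
    refine Eq.trans (Finset.sum_congr rfl fun m _ => ?_)
      (h.trans (Finset.sum_congr rfl fun m _ => ?_)) <;> ring
  have h3 : ∑ x, ∑ y, A c x y * (∑ m, r x y k m * A a m l - ∑ m, A a k m * r x y m l) =
      μ c * (A c * A a - A a * A c) k l := by
    have e2 : μ c * (A c * A a - A a * A c) k l =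
        ∑ m, (μ c * A c k m * A a m l - A a k m * (μ c * A c m l)) := by
      simp only [Matrix.sub_apply, Matrix.mul_apply, ← Finset.sum_sub_distrib]
      rw [Finset.mul_sum]
      exact Finset.sum_congr rfl fun m _ => by ring
    rw [e2]
    simp only [← hA, Finset.sum_mul]
    simp only [Finset.mul_sum, ← Finset.sum_sub_distrib]
    refine Eq.trans ?_ (sum_rotate _).symm
    refine Finset.sum_congr rfl fun x _ => Finset.sum_congr rfl fun y _ =>
      Finset.sum_congr rfl fun m _ => ?_
    ring
  have h4 : ∑ x, ∑ y, A c x y * ∑ m, A a x m * r m y k l =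
      -∑ x, ∑ y, (A a * A c) x y * r x y k l := by
    simp only [Matrix.mul_apply, Finset.sum_mul, Finset.mul_sum]
    simp only [← Finset.sum_neg_distrib]
    refine (sum_reverse _).trans ?_
    refine Finset.sum_congr rfl fun x _ => Finset.sum_congr rfl fun y _ =>
      Finset.sum_congr rfl fun m _ => ?_
    rw [skew_of_ne_zero hA hr ha m]
    ring
  have h5 : ∑ x, ∑ y, A c x y * ∑ m, A a y m * r x m k l =
      ∑ x, ∑ y, (A c * A a) x y * r x y k l := by
    simp only [Matrix.mul_apply, Finset.sum_mul, Finset.mul_sum]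
    refine Finset.sum_congr rfl fun x _ => ?_
    rw [Finset.sum_comm]
    refine Finset.sum_congr rfl fun y _ => Finset.sum_congr rfl fun m _ => ?_
    ring
  rw [← h3]
  simp only [h2, mul_add, Finset.sum_add_distrib, h4, h5, Matrix.sub_apply, sub_mul,
    Finset.sum_sub_distrib]
  ring

omit [DecidableEq ι] in
-- The bracket is an eigenvector for μ_c and, with the roles exchanged, also for μ_a, so it vanishes
-- when these differ.
theorem smul_bracket (hr : IsParallelRicciFlat r) {a c : ι × ι} (ha : μ a ≠ 0) (hc : μ c ≠ 0)
    (hac : μ a ≠ μ c) : A c * A a - A a * A c = 0 := by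
  ext k l
  have h1 := bracket_eigenvector hA hr (c := c) ha k l
  have h2 := bracket_eigenvector hA hr (c := a) hc k l
  rw [← neg_sub (A c * A a)] at h2
  simp only [Matrix.neg_apply, neg_mul, Finset.sum_neg_distrib, mul_neg, neg_inj] at h2
  have h3 : (μ a - μ c) * (A c * A a - A a * A c) k l = 0 := by rw [sub_mul, ← h1, ← h2, sub_self]
  exact (mul_eq_zero.1 h3).resolve_left (sub_ne_zero.2 hac)

omit [DecidableEq ι] hA in
include hA' in
-- This is the Ricci tensor written in the spectral decomposition.
theorem sum_smul_sq (hr : IsParallelRicciFlat r) : ∑ a, μ a • (A a * A a) = 0 := by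
  ext k l
  have h := hr.ricci l k
  simp only [hA'] at h
  rw [Finset.sum_comm] at h
  simp only [Matrix.sum_apply, Matrix.smul_apply, Matrix.mul_apply, smul_eq_mul, Matrix.zero_apply]
  rw [← h]
  refine Finset.sum_congr rfl fun a _ => ?_
  rw [Finset.mul_sum]
  exact Finset.sum_congr rfl fun i _ => by ring

include hA' in
-- One has tr(A_a A_c A_a A_c) = tr(A_a² A_c²) + ½ tr([A_c, A_a]²). The weighted sum of the first
-- terms is tr((∑ μ_a A_a²)²) = 0. In the second, brackets for distinct nonzero eigenvalues vanish;
-- for equal ones the weight is a square and the bracket is skew, so its square has nonpositive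
-- trace.
theorem sum_trace_nonpos (hr : IsParallelRicciFlat r) :
    ∑ a, ∑ c, μ a * μ c * Matrix.trace (A a * A c * A a * A c) ≤ 0 := by
  have h0 := sum_smul_sq hA' hr
  have h1 : ∑ a, ∑ c, μ a * μ c * Matrix.trace (A a * A a * (A c * A c)) = 0 := by
    have : Matrix.trace ((∑ a, μ a • (A a * A a)) * ∑ c, μ c • (A c * A c)) = 0 := by rw [h0]; simp
    rw [← this]
    simp only [Finset.sum_mul, Finset.mul_sum, Matrix.trace_sum, smul_mul_assoc, mul_smul_comm,
      Matrix.trace_smul, smul_eq_mul]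
    rw [Finset.sum_comm]
    exact Finset.sum_congr rfl fun a _ => Finset.sum_congr rfl fun c _ => by ring
  rw [← h1]
  refine Finset.sum_le_sum fun a _ => Finset.sum_le_sum fun c _ => ?_
  by_cases ha : μ a = 0
  · simp [ha]
  by_cases hc : μ c = 0
  · simp [hc]
  have h2 : Matrix.trace ((A c * A a - A a * A c) * (A c * A a - A a * A c)) =
      2 * Matrix.trace (A a * A c * A a * A c) - 2 * Matrix.trace (A a * A a * (A c * A c)) := by
    have : (A c * A a - A a * A c) * (A c * A a - A a * A c) = A c * (A a * A c * A a)
      - A c * (A a * A a * A c) - A a * (A c * A c * A a) + A a * A c * A a * A c := by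
      noncomm_ring
    rw [this, Matrix.trace_add, Matrix.trace_sub, Matrix.trace_sub, Matrix.trace_mul_comm (A c),
      Matrix.trace_mul_comm (A c), Matrix.trace_mul_comm (A a) (A c * A c * A a),
      mul_assoc (A c * A c), Matrix.trace_mul_comm (A c * A c), mul_assoc (A a * A a)]
    ring
  by_cases hac : μ a = μ c
  · have h3 : Matrix.trace ((A c * A a - A a * A c) * (A c * A a - A a * A c)) ≤ 0 := by
      refine trace_sq_nonpos ?_
      have ht : ∀ a, μ a ≠ 0 → (A a).transpose = -A a := fun a ha => by
        ext k l; exact skew_of_ne_zero hA hr ha l k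
      rw [Matrix.transpose_sub, Matrix.transpose_mul, Matrix.transpose_mul, ht a ha, ht c hc]
      noncomm_ring
    rw [hac]
    nlinarith [mul_self_nonneg (μ c)]
  · rw [smul_bracket hA hr ha hc hac, mul_zero, Matrix.trace_zero] at h2
    have : Matrix.trace (A a * A c * A a * A c) = Matrix.trace (A a * A a * (A c * A c)) := by
      linarith
    rw [this]

end

omit [DecidableEq ι] in
/-- Expansion of a quadratic expression in the curvature in terms of the eigenvectors of the
curvature operator. -/
theorem sum_mul_eq {μ : ι × ι → ℝ} {A : ι × ι → Matrix ι ι ℝ}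
    (hA' : ∀ i j k l, r i j k l = ∑ a, μ a * A a i j * A a k l) (i j k l i' j' k' l' : ι) :
    r i j k l * r i' j' k' l' =
      ∑ a, ∑ c, μ a * μ c * (A a i j * A a k l * (A c i' j' * A c k' l')) := by
  rw [hA' i, hA' i', Finset.sum_mul_sum]
  exact Finset.sum_congr rfl fun a _ => Finset.sum_congr rfl fun c _ => by ring

omit [DecidableEq ι] in
theorem sum_comm_four {κ : Type*} [Fintype κ] (f : ι → ι → ι → ι → κ → κ → ℝ) :
    ∑ i, ∑ j, ∑ k, ∑ l, ∑ a, ∑ c, f i j k l a c =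
      ∑ a, ∑ c, ∑ i, ∑ j, ∑ k, ∑ l, f i j k l a c := by
  refine Eq.trans ?_ (sum_rotate _)
  refine Finset.sum_congr rfl fun i _ => ?_
  refine Eq.trans ?_ (sum_rotate _)
  refine Finset.sum_congr rfl fun j _ => ?_
  refine Eq.trans ?_ (sum_rotate _)
  exact Finset.sum_congr rfl fun k _ => sum_rotate _

theorem sum_sq_eq {μ : ι × ι → ℝ} {A : ι × ι → Matrix ι ι ℝ}
    (hA : ∀ a b, ∑ i, ∑ j, A a i j * A b i j = if a = b then 1 else 0)
    (hA' : ∀ i j k l, r i j k l = ∑ a, μ a * A a i j * A a k l) :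
    ∑ i, ∑ j, ∑ k, ∑ l, r i j k l ^ 2 = ∑ a, μ a ^ 2 := by
  simp only [sq, sum_mul_eq hA']
  rw [sum_comm_four]
  refine Finset.sum_congr rfl fun a _ => ?_
  have : ∀ c, ∑ i, ∑ j, ∑ k, ∑ l, μ a * μ c * (A a i j * A a k l * (A c i j * A c k l)) =
      μ a * μ c * ((∑ i, ∑ j, A a i j * A c i j) * ∑ k, ∑ l, A a k l * A c k l) := fun c => by
    simp only [Finset.sum_mul, Finset.mul_sum]
    refine Finset.sum_congr rfl fun i _ => Finset.sum_congr rfl fun j _ =>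
      Finset.sum_congr rfl fun k _ => Finset.sum_congr rfl fun l _ => by ring
  simp [this, hA]

omit [DecidableEq ι] in
theorem eq_zero_of_sum_sq_nonpos (h : ∑ i, ∑ j, ∑ k, ∑ l, r i j k l ^ 2 ≤ 0) (i j k l : ι) :
    r i j k l = 0 := by
  have h0 : r i j k l ^ 2 ≤ ∑ i, ∑ j, ∑ k, ∑ l, r i j k l ^ 2 := by
    have n1 : ∀ i j k, 0 ≤ ∑ l, r i j k l ^ 2 := fun i j k =>
      Finset.sum_nonneg fun l _ => sq_nonneg _
    have n2 : ∀ i j, 0 ≤ ∑ k, ∑ l, r i j k l ^ 2 := fun i j => Finset.sum_nonneg fun k _ => n1 i j k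
    have n3 : ∀ i, 0 ≤ ∑ j, ∑ k, ∑ l, r i j k l ^ 2 := fun i => Finset.sum_nonneg fun j _ => n2 i j
    calc r i j k l ^ 2 ≤ ∑ l, r i j k l ^ 2 :=
          Finset.single_le_sum (f := fun l => r i j k l ^ 2) (fun l _ => sq_nonneg _)
            (Finset.mem_univ l)
      _ ≤ ∑ k, ∑ l, r i j k l ^ 2 :=
          Finset.single_le_sum (f := fun k => ∑ l, r i j k l ^ 2) (fun k _ => n1 i j k)
            (Finset.mem_univ k)
      _ ≤ ∑ j, ∑ k, ∑ l, r i j k l ^ 2 :=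
          Finset.single_le_sum (f := fun j => ∑ k, ∑ l, r i j k l ^ 2) (fun j _ => n2 i j)
            (Finset.mem_univ j)
      _ ≤ _ :=
          Finset.single_le_sum (f := fun i => ∑ j, ∑ k, ∑ l, r i j k l ^ 2) (fun i _ => n3 i)
            (Finset.mem_univ i)
  exact pow_eq_zero_iff two_ne_zero |>.1 (le_antisymm (h0.trans h) (sq_nonneg _))

/-- A Ricci-flat locally symmetric curvature tensor vanishes. -/
theorem eq_zero_of_bianchi (hr : IsParallelRicciFlat r)
    (hb : ∀ i j k l, r i j k l + r j k i l + r k i j l = 0) (i j k l : ι) : r i j k l = 0 := by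
  obtain ⟨μ, A, hA, hAo, hA'⟩ := exists_spectral hr.pair
  have h1 : ∑ i, ∑ j, ∑ k, ∑ l, r i j k l * r j k i l =
      -∑ a, ∑ c, μ a * μ c * Matrix.trace (A a * A c * A a * A c) := by
    simp only [sum_mul_eq hA']
    rw [sum_comm_four]
    simp only [← Finset.sum_neg_distrib]
    refine Finset.sum_congr rfl fun a _ => Finset.sum_congr rfl fun c _ => ?_
    by_cases hc : μ c = 0
    · simp [hc]
    simp only [Matrix.trace, Matrix.diag, Matrix.mul_apply, Finset.sum_mul, Finset.mul_sum,
      ← Finset.sum_neg_distrib]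
    refine Finset.sum_congr rfl fun i _ => ?_
    refine (sum_reverse _).trans (Finset.sum_congr rfl fun l _ => Finset.sum_congr rfl fun k _ =>
      Finset.sum_congr rfl fun j _ => ?_)
    rw [skew_of_ne_zero hA hr hc i l]
    ring
  have h2 : ∑ i, ∑ j, ∑ k, ∑ l, r i j k l * r k i j l =
      ∑ i, ∑ j, ∑ k, ∑ l, r i j k l * r j k i l := by
    rw [Finset.sum_comm]
    refine Finset.sum_congr rfl fun i _ => Finset.sum_congr rfl fun j _ =>
      Finset.sum_congr rfl fun k _ => Finset.sum_congr rfl fun l _ => ?_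
    rw [hr.pair j i, hr.skew k l j i, hr.pair k l i j, hr.pair k j i l, hr.skew i l k j,
      hr.pair i l j k, neg_mul_neg]
  -- The Bianchi identity paired with R: by `h2` both mixed products are equal, and by `h1` each is
  -- −Q, so |R|² = 2Q.
  have h3 : ∑ i, ∑ j, ∑ k, ∑ l, r i j k l * (r i j k l + r j k i l + r k i j l) = 0 := by
    simp only [hb, mul_zero, Finset.sum_const_zero]
  simp only [mul_add, Finset.sum_add_distrib, h2, h1, ← sq] at h3
  refine eq_zero_of_sum_sq_nonpos ?_ i j k l
  rw [sum_sq_eq hAo hA'] at *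
  linarith [sum_trace_nonpos hA hA' hr]

/-- A Ricci-flat parallel curvature tensor whose values satisfy the quartic trace identity
vanishes. -/
theorem eq_zero_of_trace (hr : IsParallelRicciFlat r)
    (hq : ∀ c : ι → ι → ℝ,
      4 * Matrix.trace ((∑ i, ∑ j, c i j • Matrix.of fun k l => r i j k l) ^ 4) =
        Matrix.trace ((∑ i, ∑ j, c i j • Matrix.of fun k l => r i j k l) ^ 2) ^ 2)
    (i j k l : ι) : r i j k l = 0 := by
  obtain ⟨μ, A, hA, hAo, hA'⟩ := exists_spectral hr.pair
  -- Every combination of A_a and A_c is one of curvature endomorphisms, with coefficients divided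
  -- by the eigenvalues, so the quartic identity can be polarized on the pair.
  have hpol : ∀ a c, μ a ≠ 0 → μ c ≠ 0 →
      8 * Matrix.trace (A a * A a * (A c * A c)) + 4 * Matrix.trace (A a * A c * A a * A c) =
      Matrix.trace (A a * A a) * Matrix.trace (A c * A c) + 2 * Matrix.trace (A a * A c) ^ 2 :=
    fun a c ha hc => trace_polarization fun s t => by
      have h1 : s • A a + t • A c = ∑ i, ∑ j, (s / μ a * A a i j + t / μ c * A c i j) •
          Matrix.of fun k l => r i j k l := by
        simp only [add_smul, Finset.sum_add_distrib, mul_smul, ← Finset.smul_sum,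
          ← smul_eq_sum hA]
        rw [smul_smul, smul_smul, div_mul_cancel₀ _ ha, div_mul_cancel₀ _ hc]
      rw [h1]
      exact hq _
  -- Skewness of A_c turns the trace of A_a A_c into minus the inner product, which is −δ_ac.
  have htr : ∀ a c, μ a * μ c * Matrix.trace (A a * A c) ^ 2 = if a = c then μ a ^ 2 else 0 := by
    intro a c
    by_cases hc : μ c = 0
    · split_ifs with h
      · simp [h, hc]
      · simp [hc]
    have : Matrix.trace (A a * A c) = -if a = c then 1 else 0 := by
      rw [← hAo]
      simp only [Matrix.trace, Matrix.diag, Matrix.mul_apply, ← Finset.sum_neg_distrib]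
      refine Finset.sum_congr rfl fun i _ => Finset.sum_congr rfl fun j _ => ?_
      rw [skew_of_ne_zero hA hr hc, mul_neg]
    rw [this]
    split_ifs with h
    · rw [h]; ring
    · ring
  have h0 := sum_smul_sq hA' hr
  have h1 : ∑ a, ∑ c, μ a * μ c * Matrix.trace (A a * A a * (A c * A c)) = 0 := by
    have : Matrix.trace ((∑ a, μ a • (A a * A a)) * ∑ c, μ c • (A c * A c)) = 0 := by rw [h0]; simp
    rw [← this]
    simp only [Finset.sum_mul, Finset.mul_sum, Matrix.trace_sum, smul_mul_assoc, mul_smul_comm,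
      Matrix.trace_smul, smul_eq_mul]
    rw [Finset.sum_comm]
    exact Finset.sum_congr rfl fun a _ => Finset.sum_congr rfl fun c _ => by ring
  have h2 : ∑ a, ∑ c, μ a * μ c * (Matrix.trace (A a * A a) * Matrix.trace (A c * A c)) = 0 := by
    have : Matrix.trace (∑ a, μ a • (A a * A a)) * Matrix.trace (∑ c, μ c • (A c * A c)) = 0 := by
      rw [h0]; simp
    rw [← this]
    simp only [Matrix.trace_sum, Finset.sum_mul, Finset.mul_sum, Matrix.trace_smul, smul_eq_mul]
    rw [Finset.sum_comm]
    exact Finset.sum_congr rfl fun a _ => Finset.sum_congr rfl fun c _ => by ring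
  have h3 : ∀ a c, 8 * (μ a * μ c * Matrix.trace (A a * A a * (A c * A c)))
      + 4 * (μ a * μ c * Matrix.trace (A a * A c * A a * A c)) =
      μ a * μ c * (Matrix.trace (A a * A a) * Matrix.trace (A c * A c))
        + 2 * if a = c then μ a ^ 2 else 0 := fun a c => by
    rw [← htr]
    by_cases ha : μ a = 0
    · simp [ha]
    by_cases hc : μ c = 0
    · simp [hc]
    linear_combination μ a * μ c * hpol a c ha hc
  -- Summing over a and c, both the A_a² A_c² traces and the product traces vanish by Ric³ = 0,
  -- which leaves 4Q = 2|R|².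
  have h4 := Finset.sum_congr rfl fun a (_ : a ∈ Finset.univ) =>
    Finset.sum_congr rfl fun c (_ : c ∈ Finset.univ) => h3 a c
  simp only [Finset.sum_add_distrib, ← Finset.mul_sum, h1, h2] at h4
  simp only [Finset.sum_ite_eq, Finset.mem_univ, if_true] at h4
  refine eq_zero_of_sum_sq_nonpos ?_ i j k l
  rw [sum_sq_eq hAo hA']
  linarith [sum_trace_nonpos hA hA' hr]

end CurvatureTensor

/-! ### Newton's identity for traceless maps with a kernel in dimension at most four -/

/-- A Newton identity for traceless matrices of size four. -/
theorem Matrix.trace_pow_four_add_det {K : Type*} [Field K] (A : Matrix (Fin 4) (Fin 4) K)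
    (hA : A.trace = 0) : 2 * (A ^ 4).trace + 8 * A.det = (A ^ 2).trace ^ 2 := by
  have h : A 3 3 = -(A 0 0 + A 1 1 + A 2 2) := by
    simp only [Matrix.trace, Matrix.diag, Fin.sum_univ_four] at hA
    linear_combination hA
  have hB : A ^ 4 = A ^ 2 * A ^ 2 := by rw [← pow_add]
  have h2 : ∀ i j, (A ^ 2) i j = A i 0 * A 0 j + A i 1 * A 1 j + A i 2 * A 2 j + A i 3 * A 3 j :=
    fun i j => by rw [sq, Matrix.mul_apply, Fin.sum_univ_four]
  rw [hB]
  simp only [Matrix.trace, Matrix.diag, Matrix.mul_apply, h2, Matrix.det_succ_row_zero,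
    Fin.sum_univ_succ, Matrix.submatrix_apply]
  simp [Fin.succAbove, h]
  ring

/-- The quartic trace identity for a traceless singular endomorphism in dimension at most four. -/
theorem LinearMap.trace_pow_four {K V : Type*} [Field K]
    [AddCommGroup V] [Module K V] [FiniteDimensional K V] (hV : Module.finrank K V ≤ 4)
    {f : Module.End K V} (hf : LinearMap.trace K V f = 0) {x : V} (hx : x ≠ 0) (hfx : f x = 0) :
    2 * LinearMap.trace K V (f ^ 4) = LinearMap.trace K V (f ^ 2) ^ 2 := by
  -- Adding a zero block brings the dimension to exactly four without changing the traces of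
  -- positive powers; the kernel vector still kills the determinant.
  let W := V × (Fin (4 - Module.finrank K V) → K)
  let g : Module.End K W := f.prodMap 0
  have hW : Module.finrank K W = 4 := by simp [W, Module.finrank_prod]; omega
  have hg : ∀ k, LinearMap.trace K W (g ^ (k + 1)) = LinearMap.trace K V (f ^ (k + 1)) := fun k => by
    have : g ^ (k + 1) = (f ^ (k + 1)).prodMap 0 := by
      induction k with
      | zero => simp [g]
      | succ k ih => rw [pow_succ, ih, pow_succ f]; rfl
    rw [this, LinearMap.trace_prodMap', map_zero, add_zero]
  have hdet : LinearMap.det g = 0 := by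
    refine LinearMap.det_eq_zero_iff_ker_ne_bot.2 ((LinearMap.ker g).ne_bot_iff.2
      ⟨(x, 0), ?_, fun h => hx (congrArg Prod.fst h)⟩)
    rw [LinearMap.mem_ker]
    exact Prod.ext hfx rfl
  let b := Module.finBasisOfFinrankEq K W hW
  have key := Matrix.trace_pow_four_add_det (LinearMap.toMatrixAlgEquiv b g) (by
    have := hg 0
    rw [zero_add, pow_one, pow_one, hf, LinearMap.trace_eq_matrix_trace K b] at this
    exact this)
  rw [← map_pow, ← map_pow] at key
  have e : ∀ h : Module.End K W, (LinearMap.toMatrixAlgEquiv b h).trace = LinearMap.trace K W h :=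
    fun h => (LinearMap.trace_eq_matrix_trace K b h).symm
  have hd : (LinearMap.toMatrixAlgEquiv b g).det = 0 := by
    rw [← hdet]; exact LinearMap.det_toMatrix b g
  rw [e, e, hd, hg, hg] at key
  linear_combination key

theorem LinearMap.trace_restrictScalars_complex {E : Type*} [AddCommGroup E] [Module ℂ E]
    [FiniteDimensional ℂ E] (f : E →ₗ[ℂ] E) :
    LinearMap.trace ℝ E (f.restrictScalars ℝ) = 2 * (LinearMap.trace ℂ E f).re := by
  let b := Module.finBasis ℂ E
  rw [LinearMap.trace_eq_matrix_trace ℂ b, LinearMap.trace_eq_matrix_trace ℝ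
    (Complex.basisOneI.smulTower b)]
  simp only [Matrix.trace, Matrix.diag, LinearMap.toMatrix_apply, Fintype.sum_prod_type,
    Fin.sum_univ_two]
  simp [Module.Basis.smulTower_repr, Complex.re_sum, two_mul]

/-- The real version of the quartic trace identity for complex linear endomorphisms. -/
theorem LinearMap.trace_pow_four_real {E : Type*} [AddCommGroup E] [Module ℂ E]
    [FiniteDimensional ℂ E] (hE : Module.finrank ℂ E ≤ 4) {f : Module.End ℂ E}
    (h0 : LinearMap.trace ℝ E (f.restrictScalars ℝ) = 0)
    (h1 : LinearMap.trace ℝ E ((Complex.I • f).restrictScalars ℝ) = 0)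
    (h2 : LinearMap.trace ℝ E ((Complex.I • f ^ 2).restrictScalars ℝ) = 0)
    {x : E} (hx : x ≠ 0) (hfx : f x = 0) :
    4 * LinearMap.trace ℝ E ((f ^ 4).restrictScalars ℝ) =
      LinearMap.trace ℝ E ((f ^ 2).restrictScalars ℝ) ^ 2 := by
  rw [trace_restrictScalars_complex] at *
  simp only [map_smul, smul_eq_mul, Complex.mul_re, Complex.I_re, Complex.I_im, zero_mul, one_mul,
    zero_sub] at h1 h2
  have h3 : LinearMap.trace ℂ E f = 0 := Complex.ext (by simpa using h0) (by simpa using h1)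
  have h4 := congrArg Complex.re (LinearMap.trace_pow_four hE h3 hx hfx)
  -- Since tr f² is real, the real part of its square is the square of its real part. Real traces
  -- are twice real parts, which turns the factor 2 into 4.
  have h5 : (LinearMap.trace ℂ E (f ^ 2)).im = 0 := by linarith
  rw [sq, Complex.mul_re, Complex.mul_re, h5] at h4
  simp only [Complex.re_ofNat, Complex.im_ofNat, zero_mul, sub_zero, mul_zero] at h4
  rw [trace_restrictScalars_complex]
  linear_combination 4 * h4

namespace HermitianLocal

/-! ### Pointwise vanishing of torsion and curvature -/

namespace IsHermitianMetricOn

variable {E : Type*} [NormedAddCommGroup E] [NormedSpace ℂ E] [FiniteDimensional ℂ E]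
  {G : E → E →L[ℝ] E →L[ℝ] ℝ} {U : Set E} (hG : IsHermitianMetricOn G U)
  {p : E} (hp : p ∈ U) {ι : Type*} [Fintype ι] [DecidableEq ι] {e : Module.Basis ι ℝ E}
  (he : ∀ i j, G p (e i) (e j) = if i = j then 1 else 0)

include hG hp he

/-- The components of the curvature in an orthonormal basis. -/
theorem isParallelRicciFlat (hT : TorsionParallelAt (bismut G) p)
    (hR : ∀ q ∈ U, CurvatureParallelAt (bismut G) q)
    (h3 : ∀ x y, ricciThird (bismut G) p x y = 0) :
    CurvatureTensor.IsParallelRicciFlat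
      fun i j k l => G p (curvature (bismut G) p (e i) (e j) (e k)) (e l) where
  skew i j k l := hG.curvature_skew hp _ _ _ _
  pair i j k l := hG.curvature_pair hp hT _ _ _ _
  ricci j k := by
    rw [← h3 (e j) (e k), ricciThird, trace_eq he]; rfl
  parallel u v x y k l := by
    set R := curvature (bismut G) p with hRdef
    have key := congrArg (fun w => G p w (e l))
      (curvature_curvature hG.isOpen (hG.bismut_contDiffOn.differentiableOn (by simp))
        hG.curvature_contDiffOn hR hp (e u) (e v) (e x) (e y) (e k))
    rw [← hRdef] at key
    have e1 : ∀ a b c d, ∑ m, G p a (e m) * G p (R b c (e m)) d = G p (R b c a) d :=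
      fun a b c d => by
        conv_rhs => rw [← sum_apply_smul he a]
        simp
    have e2 : ∀ a b c d, ∑ m, G p a (e m) * G p (R (e m) b c) d = G p (R a b c) d :=
      fun a b c d => by
        conv_rhs => rw [← sum_apply_smul he a]
        simp
    have e3 : ∀ a b c d, ∑ m, G p a (e m) * G p (R b (e m) c) d = G p (R b a c) d :=
      fun a b c d => by
        conv_rhs => rw [← sum_apply_smul he a]
        simp
    simp only [e1, e2, e3, map_add, add_apply] at key ⊢
    linarith

/-- The curvature annihilates the trace of the torsion. -/
theorem curvature_sum_torsion_I (hT : ∀ q ∈ U, TorsionParallelAt (bismut G) q) (x y : E) :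
    curvature (bismut G) p x y (∑ i, torsion (bismut G) p (e i) (Complex.I • e i)) = 0 := by
  set R := curvature (bismut G) p with hR
  set T := torsion (bismut G) p with hTdef
  have key : ∀ i, R x y (T (e i) (Complex.I • e i)) =
      ∑ k, G p (R x y (e i)) (e k) • T (e k) (Complex.I • e i)
        + ∑ k, G p (R x y (e i)) (e k) • T (e i) (Complex.I • e k) := fun i => by
    rw [hR, curvature_torsion hG.isOpen (hG.bismut_contDiffOn.differentiableOn (by simp))
      hG.torsion_contDiffOn hT hp x y, hG.curvature_I hp, ← hR, ← hTdef]
    conv_lhs => rw [← sum_apply_smul he (R x y (e i))]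
    simp only [map_sum, map_smul, sum_apply, smul_apply, Finset.smul_sum, smul_comm Complex.I]
  rw [map_sum]
  simp only [key, Finset.sum_add_distrib]
  -- R(x, y) differentiates T and commutes with J. After exchanging i and k in the first sum, the
  -- same vectors T(e_i, J e_k) occur with coefficients that cancel because R(x, y) is skew.
  rw [Finset.sum_comm, ← Finset.sum_add_distrib]
  refine Finset.sum_eq_zero fun i _ => ?_
  rw [← Finset.sum_add_distrib]
  refine Finset.sum_eq_zero fun k _ => ?_
  rw [← add_smul, hG.curvature_skew hp x y (e k)]
  simp [hR]

/-- The curvature operators as complex linear maps satisfy the quartic trace identity, if they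
have a common kernel. -/
theorem curvature_trace_pow_four (hn : Module.finrank ℂ E ≤ 4)
    (h1 : ∀ x y, ricciFirst (bismut G) p x y = 0) {ξ : E} (hξ : ξ ≠ 0)
    (hRξ : ∀ x y, curvature (bismut G) p x y ξ = 0) (c : ι → ι → ℝ) :
    4 * Matrix.trace ((∑ i, ∑ j, c i j • Matrix.of fun k l =>
        G p (curvature (bismut G) p (e i) (e j) (e k)) (e l)) ^ 4) =
      Matrix.trace ((∑ i, ∑ j, c i j • Matrix.of fun k l =>
        G p (curvature (bismut G) p (e i) (e j) (e k)) (e l)) ^ 2) ^ 2 := by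
  set R := curvature (bismut G) p with hR
  let F : E →L[ℝ] E := ∑ i, ∑ j, c i j • R (e i) (e j)
  have hF : ∀ x, F x = ∑ i, ∑ j, c i j • R (e i) (e j) x := fun x => by
    simp [F, sum_apply]
  have hFI : ∀ x, F (Complex.I • x) = Complex.I • F x := fun x => by
    simp only [hF, hR, hG.curvature_I hp, Finset.smul_sum, smul_comm Complex.I]
  let f : Module.End ℂ E :=
    { toFun := F
      map_add' := map_add F
      map_smul' := fun z x => by
        have : ∀ x : E, z • x = z.re • x + z.im • Complex.I • x := fun x => by
          conv_lhs => rw [← Complex.re_add_im z, add_smul, mul_smul]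
          rfl
        simp only [RingHom.id_apply, this, map_add, map_smul, hFI] }
  have hf : ∀ x, f x = F x := fun _ => rfl
  have hskew : ∀ x y, G p (f x) y = -G p x (f y) := fun x y => by
    rw [hG.symm p hp x]
    simp only [hf, hF, map_sum, sum_apply, map_smul, smul_apply, ← Finset.sum_neg_distrib]
    exact Finset.sum_congr rfl fun i _ => Finset.sum_congr rfl fun j _ => by
      rw [hG.curvature_skew hp, smul_neg]
  have hself : ∀ x, G p x (f x) = 0 := fun x => by
    have := hskew x x
    rw [hG.symm p hp] at this
    linarith
  have hM : (∑ i, ∑ j, c i j • Matrix.of fun k l => G p (R (e i) (e j) (e k)) (e l)) =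
      (LinearMap.toMatrixAlgEquiv e (f.restrictScalars ℝ)).transpose := by
    ext k l
    rw [Matrix.transpose_apply, LinearMap.toMatrixAlgEquiv_apply, repr_eq he]
    change _ = G p (F (e k)) (e l)
    rw [hF]
    simp [Matrix.sum_apply]
  have hpow : ∀ m : ℕ, (f ^ m).restrictScalars ℝ = (f.restrictScalars ℝ : Module.End ℝ E) ^ m :=
    fun m => by
      induction m with
      | zero => rfl
      | succ m ih => rw [pow_succ, pow_succ, ← ih]; rfl
  have htr : ∀ m : ℕ, Matrix.trace (((LinearMap.toMatrixAlgEquiv e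
      (f.restrictScalars ℝ)).transpose) ^ m) =
        LinearMap.trace ℝ E ((f ^ m).restrictScalars ℝ) := fun m => by
    rw [← Matrix.transpose_pow, Matrix.trace_transpose, ← map_pow, hpow]
    exact (LinearMap.trace_eq_matrix_trace ℝ e _).symm
  rw [hM, htr, htr]
  -- The real trace vanishes because f is skew and the trace of J f by Ric¹. The trace of J f²
  -- vanishes because ⟨J f² v, v⟩ = ⟨f v, J f v⟩ = 0.
  refine LinearMap.trace_pow_four_real hn ?_ ?_ ?_ hξ ?_
  · rw [trace_eq he]
    exact Finset.sum_eq_zero fun i _ => by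
      rw [hG.symm p hp]; exact hself _
  · have : (Complex.I • f).restrictScalars ℝ = ∑ i, ∑ j, c i j •
        ((Complex.I • R (e i) (e j) : E →L[ℝ] E) : E →ₗ[ℝ] E) := by
      ext x
      change Complex.I • F x = _
      simp [hF, Finset.smul_sum, smul_comm Complex.I, LinearMap.sum_apply]
    rw [this]
    simp only [map_sum, map_smul, hR, trace_I_smul_curvature (h1 _ _), smul_zero,
      Finset.sum_const_zero]
  · rw [trace_eq he]
    refine Finset.sum_eq_zero fun i _ => ?_
    change G p (Complex.I • (f ^ 2) (e i)) (e i) = 0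
    rw [sq, Module.End.mul_apply, hG.apply_I hp, hskew, map_smul, neg_neg]
    have := hG.apply_I hp (f (e i)) (f (e i))
    rw [hG.symm p hp] at this
    linarith
  · change F ξ = 0
    simp [hF, hRξ]

/-- If the trace of the torsion vanishes, then so does the torsion. -/
theorem torsion_eq_zero (h : TorsionParallelAt (bismut G) p)
    (h1 : ∀ x y, ricciFirst (bismut G) p x y = 0) (h3 : ∀ x y, ricciThird (bismut G) p x y = 0)
    (hξ : ∑ i, torsion (bismut G) p (e i) (Complex.I • e i) = 0) :
    torsion (bismut G) p = 0 := by
  have key := hG.norm_sum_torsion_I hp he h h1 h3 rfl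
  rw [hξ, map_zero, mul_zero, eq_comm, mul_eq_zero_iff_left two_ne_zero] at key
  have n2 : ∀ i j, 0 ≤ ∑ k, G p (torsion (bismut G) p (e i) (e j)) (e k) ^ 2 := fun i j =>
    Finset.sum_nonneg fun k _ => sq_nonneg _
  have h0 : ∀ i j, torsion (bismut G) p (e i) (e j) = 0 := fun i j => by
    have k1 := (Finset.sum_eq_zero_iff_of_nonneg fun i _ => Finset.sum_nonneg fun j _ => n2 i j).1
      key i (Finset.mem_univ i)
    have k2 := (Finset.sum_eq_zero_iff_of_nonneg fun j _ => n2 i j).1 k1 j (Finset.mem_univ j)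
    have k3 := (Finset.sum_eq_zero_iff_of_nonneg fun k _ => sq_nonneg _).1 k2
    rw [← sum_apply_smul he (torsion (bismut G) p (e i) (e j))]
    exact Finset.sum_eq_zero fun k hk => by rw [pow_eq_zero_iff two_ne_zero |>.1 (k3 k hk), zero_smul]
  ext x y
  rw [← sum_apply_smul he x, ← sum_apply_smul he y]
  simp [sum_apply, h0]

omit he in
/-- A Bismut Ambrose-Singer metric with vanishing first and third Ricci curvature in complex
dimension at most four is Bismut flat. -/
theorem curvature_eq_zero (hn : Module.finrank ℂ E ≤ 4)
    (hT : ∀ q ∈ U, TorsionParallelAt (bismut G) q)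
    (hR : ∀ q ∈ U, CurvatureParallelAt (bismut G) q)
    (h1 : ∀ x y, ricciFirst (bismut G) p x y = 0)
    (h3 : ∀ x y, ricciThird (bismut G) p x y = 0) :
    curvature (bismut G) p = 0 := by
  obtain ⟨e, he⟩ := hG.exists_orthonormal_basis hp
  have hr := hG.isParallelRicciFlat hp he (hT p hp) hR h3
  have key : ∀ i j k l, G p (curvature (bismut G) p (e i) (e j) (e k)) (e l) = 0 := by
    -- The case distinction is made at the point p only, so no global information about ξ is needed.
    by_cases hξ : ∑ i, torsion (bismut G) p (e i) (Complex.I • e i) = 0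
    · have hT0 := hG.torsion_eq_zero hp he (hT p hp) h1 h3 hξ
      refine CurvatureTensor.eq_zero_of_bianchi hr fun i j k l => ?_
      have := congrArg (fun w => G p w (e l)) (hG.bismut_bianchi hp (hT p hp) (e i) (e j) (e k))
      simpa [hT0] using this
    · exact CurvatureTensor.eq_zero_of_trace hr
        (hG.curvature_trace_pow_four hp he hn h1 hξ (hG.curvature_sum_torsion_I hp he hT))
  have h0 : ∀ i j k, curvature (bismut G) p (e i) (e j) (e k) = 0 := fun i j k => by
    rw [← sum_apply_smul he (curvature (bismut G) p (e i) (e j) (e k))]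
    simp [key]
  ext x y z
  rw [← sum_apply_smul he x, ← sum_apply_smul he y, ← sum_apply_smul he z]
  simp [sum_apply, h0]

end IsHermitianMetricOn

end HermitianLocal

/-! ### The metric in a holomorphic chart -/

namespace HermitianManifold

variable {E : Type*} [NormedAddCommGroup E] [NormedSpace ℂ E]
  {M : Type*} [TopologicalSpace M] [ChartedSpace E M] [IsManifold 𝓘(ℂ, E) ω M]

theorem contMDiffOn_symm {e : OpenPartialHomeomorph M E} (he : e ∈ atlas E M) :
    ContMDiffOn 𝓘(ℝ, E) 𝓘(ℝ, E) ω e.symm e.target :=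
  contMDiffOn_symm_of_mem_maximalAtlas (IsManifold.subset_maximalAtlas he)

/-- The chart is holomorphic, so by uniqueness its real derivative is the complex one with scalars
restricted. This carries the Hermitian condition into the chart. -/
theorem mfderiv_symm_I {e : OpenPartialHomeomorph M E} (he : e ∈ atlas E M) {p : E}
    (hp : p ∈ e.target) (x : E) :
    mfderiv 𝓘(ℝ, E) 𝓘(ℝ, E) e.symm p (Complex.I • x : E) =
      complexStructure (e.symm p) (mfderiv 𝓘(ℝ, E) 𝓘(ℝ, E) e.symm p x) := by
  have h1 : MDifferentiableAt 𝓘(ℂ, E) 𝓘(ℂ, E) e.symm p :=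
    ((contMDiffOn_symm_of_mem_maximalAtlas (I := 𝓘(ℂ, E)) (n := ω)
      (IsManifold.subset_maximalAtlas he)).contMDiffAt
        (e.open_target.mem_nhds hp)).mdifferentiableAt (by simp)
  have h2 : MDifferentiableAt 𝓘(ℝ, E) 𝓘(ℝ, E) e.symm p :=
    ((contMDiffOn_symm he).contMDiffAt (e.open_target.mem_nhds hp)).mdifferentiableAt (by simp)
  let A : E →L[ℂ] E := mfderiv 𝓘(ℂ, E) 𝓘(ℂ, E) e.symm p
  let B : E →L[ℝ] E := mfderiv 𝓘(ℝ, E) 𝓘(ℝ, E) e.symm p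
  have h3 : HasFDerivWithinAt (writtenInExtChartAt 𝓘(ℂ, E) 𝓘(ℂ, E) p e.symm) A
    (Set.range 𝓘(ℂ, E)) p := h1.hasMFDerivAt.2
  have h4 : HasFDerivWithinAt (writtenInExtChartAt 𝓘(ℝ, E) 𝓘(ℝ, E) p e.symm) B
    (Set.range 𝓘(ℝ, E)) p := h2.hasMFDerivAt.2
  rw [ModelWithCorners.range_eq_univ] at h3 h4
  have h5 : B = A.restrictScalars ℝ :=
    (hasFDerivWithinAt_univ.1 h4).unique ((hasFDerivWithinAt_univ.1 h3).restrictScalars ℝ)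
  change B (Complex.I • x) = Complex.I • B x
  rw [h5]
  exact map_smul A Complex.I x

theorem mfderiv_symm_injective {e : OpenPartialHomeomorph M E} (he : e ∈ atlas E M) {p : E}
    (hp : p ∈ e.target) : Function.Injective (mfderiv 𝓘(ℝ, E) 𝓘(ℝ, E) e.symm p) := by
  have hm : e ∈ IsManifold.maximalAtlas 𝓘(ℝ, E) ω M := IsManifold.subset_maximalAtlas he
  have h : e.MDifferentiable 𝓘(ℝ, E) 𝓘(ℝ, E) :=
    ⟨(contMDiffOn_of_mem_maximalAtlas hm).mdifferentiableOn (by simp),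
      (contMDiffOn_symm_of_mem_maximalAtlas hm).mdifferentiableOn (by simp)⟩
  exact h.symm.mfderiv_injective hp

/-- The fibrewise inner product and bundle structures are implicit arguments, found by unification
with `h` instead of instance search. -/
theorem contMDiffOn_inner_bundle
    {EB : Type*} [NormedAddCommGroup EB] [NormedSpace ℝ EB]
    {HB : Type*} [TopologicalSpace HB] {IB : ModelWithCorners ℝ EB HB} {n : ℕ∞ω}
    {B : Type*} [TopologicalSpace B] [ChartedSpace HB B]
    {F : Type*} [NormedAddCommGroup F] [NormedSpace ℝ F]
    {E : B → Type*} [TopologicalSpace (TotalSpace F E)] {i1 : ∀ x, NormedAddCommGroup (E x)}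
    {i2 : ∀ x, InnerProductSpace ℝ (E x)} {i3 : FiberBundle F E} {i4 : VectorBundle ℝ F E}
    (h : IsContMDiffRiemannianBundle IB n F E)
    {EM : Type*} [NormedAddCommGroup EM] [NormedSpace ℝ EM]
    {HM : Type*} [TopologicalSpace HM] {IM : ModelWithCorners ℝ EM HM}
    {M : Type*} [TopologicalSpace M] [ChartedSpace HM M]
    {b : M → B} {v w : ∀ x, E (b x)} {s : Set M}
    (hv : ContMDiffOn IM (IB.prod 𝓘(ℝ, F)) n (fun m ↦ (v m : TotalSpace F E)) s)
    (hw : ContMDiffOn IM (IB.prod 𝓘(ℝ, F)) n (fun m ↦ (w m : TotalSpace F E)) s) :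
    ContMDiffOn IM 𝓘(ℝ) n (fun m ↦ inner ℝ (v m) (w m)) s :=
  hv.inner_bundle hw

variable [RiemannianBundle (fun m : M => TangentSpace 𝓘(ℝ, E) m)]
    [IsContMDiffRiemannianBundle 𝓘(ℝ, E) ∞ E (fun m : M => TangentSpace 𝓘(ℝ, E) m)]

omit [IsManifold 𝓘(ℂ, E) ω M]
  [IsContMDiffRiemannianBundle 𝓘(ℝ, E) ∞ E fun m : M => TangentSpace 𝓘(ℝ, E) m] in
theorem metricInChart_apply (e : OpenPartialHomeomorph M E) (p x y : E) :
    metricInChart e p x y = inner ℝ (mfderiv 𝓘(ℝ, E) 𝓘(ℝ, E) e.symm p x)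
      (mfderiv 𝓘(ℝ, E) 𝓘(ℝ, E) e.symm p y) := rfl

theorem contDiffOn_metricInChart_apply {e : OpenPartialHomeomorph M E} (he : e ∈ atlas E M)
    (x y : E) : ContDiffOn ℝ ∞ (fun p => metricInChart e p x y) e.target := by
  -- The coordinate vector field of x is the tangent map of the inverse chart applied to the
  -- constant field x, hence smooth.
  have hs : ∀ x : E, ContMDiffOn 𝓘(ℝ, E) (𝓘(ℝ, E).prod 𝓘(ℝ, E)) ∞
      (fun p : E => (⟨e.symm p, mfderiv 𝓘(ℝ, E) 𝓘(ℝ, E) e.symm p x⟩ :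
        TotalSpace E (fun m : M => TangentSpace 𝓘(ℝ, E) m))) e.target := fun x => by
    have h1 := (contMDiffOn_symm he).contMDiffOn_tangentMapWithin (m := ∞) (n := ω) (by simp)
      e.open_target.uniqueMDiffOn
    have h2 : ContMDiff 𝓘(ℝ, E) (𝓘(ℝ, E).prod 𝓘(ℝ, E)) ∞
      (fun p : E => (⟨p, x⟩ : TangentBundle 𝓘(ℝ, E) E)) := by
      exact contMDiff_vectorSpace_iff_contDiff.2 (contDiff_const (c := x))
    refine (h1.comp h2.contMDiffOn (fun p hp => hp)).congr fun p hp => ?_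
    simp only [Function.comp_apply, tangentMapWithin]
    rw [mfderivWithin_of_isOpen e.open_target hp]
  exact (contMDiffOn_inner_bundle ‹IsContMDiffRiemannianBundle 𝓘(ℝ, E) ∞ E
    (fun m : M => TangentSpace 𝓘(ℝ, E) m)› (hs x) (hs y)).contDiffOn

theorem isHermitianMetricOn_metricInChart [FiniteDimensional ℂ E] (hH : IsHermitian E M)
    {e : OpenPartialHomeomorph M E} (he : e ∈ atlas E M) :
    HermitianLocal.IsHermitianMetricOn (metricInChart e) e.target where
  isOpen := e.open_target
  contDiffOn := contDiffOn_clm_apply.2 fun x => contDiffOn_clm_apply.2 fun y =>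
    contDiffOn_metricInChart_apply he x y
  symm p _ x y := real_inner_comm (F := TangentSpace 𝓘(ℝ, E) (e.symm p)) _ _
  pos p hp x hx := by
    rw [metricInChart_apply]
    exact real_inner_self_pos (F := TangentSpace 𝓘(ℝ, E) (e.symm p)).2 fun h =>
      hx (mfderiv_symm_injective he hp (h.trans (map_zero _).symm))
  herm p hp x y := by
    rw [metricInChart_apply, mfderiv_symm_I he hp, mfderiv_symm_I he hp, hH, metricInChart_apply]

end HermitianManifold

namespace HermitianLocal

/-- A balanced metric with parallel Bismut torsion and vanishing first and third Bismut Ricci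
curvature is Kähler. -/
theorem IsHermitianMetricOn.dOmega_eq_zero {E : Type*} [NormedAddCommGroup E] [NormedSpace ℂ E]
    [FiniteDimensional ℂ E] {G : E → E →L[ℝ] E →L[ℝ] ℝ} {U : Set E}
    (hG : IsHermitianMetricOn G U) {p : E} (hp : p ∈ U)
    (hT : TorsionParallelAt (bismut G) p) (h1 : ∀ x y, ricciFirst (bismut G) p x y = 0)
    (h3 : ∀ x y, ricciThird (bismut G) p x y = 0) (hb : ∀ x, torsionOneForm G p x = 0)
    (x y z : E) : dOmega G p x y z = 0 := by
  obtain ⟨e, he⟩ := hG.exists_orthonormal_basis hp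
  have hξ : ∑ i, torsion (bismut G) p (e i) (Complex.I • e i) = 0 := by
    rw [hG.ext_iff_apply hp]
    intro x
    rw [map_sum, sum_apply, hG.sum_torsion_I hp he, hb]
    simp
  -- Inserting −J x, −J y, −J z undoes the three J's in the formula for T and leaves dω(x, y, z).
  have h := hG.torsion_bismut hp (-(Complex.I • x)) (-(Complex.I • y)) (-(Complex.I • z))
  rw [hG.torsion_eq_zero hp he hT h1 h3 hξ] at h
  simpa only [smul_neg, Complex.I_smul_I_smul, neg_neg, zero_apply, map_zero, eq_comm] using h

end HermitianLocal

theorem theorem1p7 {E : Type*} [NormedAddCommGroup E] [NormedSpace ℂ E] [FiniteDimensional ℂ E]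
    {M : Type*} [EMetricSpace M] [ChartedSpace E M] [IsManifold 𝓘(ℂ, E) ω M]
    [RiemannianBundle (fun m : M => TangentSpace 𝓘(ℝ, E) m)]
    [IsContMDiffRiemannianBundle 𝓘(ℝ, E) ∞ E (fun m : M => TangentSpace 𝓘(ℝ, E) m)]
    [IsRiemannianManifold 𝓘(ℝ, E) M] [CompleteSpace M]
    (hHerm : HermitianManifold.IsHermitian E M)
    (hKahler : ¬ HermitianManifold.IsKahler E M)
    (hBAS : HermitianManifold.IsBismutAmbroseSinger E M)
    (hRic1 : HermitianManifold.FirstBismutRicciFlat E M)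
    (hRic3 : HermitianManifold.ThirdBismutRicciFlat E M) :
    ¬ HermitianManifold.IsBalanced E M ∧
      (Module.finrank ℂ E ≤ 4 → HermitianManifold.IsBismutFlat E M) := by
  have hG := fun e (he : e ∈ atlas E M) =>
    HermitianManifold.isHermitianMetricOn_metricInChart hHerm he
  refine ⟨fun hb => hKahler fun e he p hp => ?_, fun hn e he p hp => ?_⟩
  · exact (hG e he).dOmega_eq_zero hp (hBAS e he p hp).1 (hRic1 e he p hp) (hRic3 e he p hp)
      (hb e he p hp)
  · exact (hG e he).curvature_eq_zero hp hn (fun q hq => (hBAS e he q hq).1)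
      (fun q hq => (hBAS e he q hq).2) (hRic1 e he p hp) (hRic3 e he p hp)
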